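/- Conventions. A first-order structure $S$ in a language with effectively numbered symbols is called decidable if there is an algorithm which, given (the Gödel number of) a sentence of the language, decides whether the sentence is true in $S$. Lattices of sets are regarded as structures in the language $\{\leq\}$, interpreted as inclusion. Divisible abelian $\ell$-groups are regarded as structures in the language $\{+,-,(f_q \mid q\in\mathbb{Q}),\leq\}$, where $f_q$ is interpreted as multiplication by $q$. Let $M$ be a divisible totally ordered abelian group with its order topology, let $X$ be a Hausdorff space, and let $C$ be a $\mathbb{Q}$-vector sublattice of $M^X$ (pointwise operations and order) that consists of continuous functions. A $C$-zero set is a set $\{f=0\}$ with $f\in C$; a $C$-cozero set is the complement of a $C$-zero set; a $C$-constructible set is a Boolean combination of $C$-zero sets. A map $g\colon Z\to M$ on a $C$-constructible set $Z\subseteq X$ is $C$-constructible if there are $C$-constructible sets $Z_1,\dots,Z_n$ with $Z=Z_1\cup\dots\cup Z_n$ and $f_1,\dots,f_n\in C$ with $g|_{Z_i}=f_i|_{Z_i}$ for all $i$. Call $C$ a constructible $\ell$-group if (C1) every closed $C$-constructible set is a $C$-zero set; (C2) the closure of every $C$-cozero set is $C$-constructible; (C3) if $A\subseteq X$ is closed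 and $C$-constructible, then every continuous $C$-constructible function $A\to M$ extends to a function from $C$; (C4) if $A_1,\dots,A_n\subseteq X$ are closed and $C$-constructible with $X=A_1\cup\dots\cup A_n$, and $f\colon X\to M$ is a function such that each $f|_{A_i}$ is continuous and $C$-constructible, then $f\in C$. Let $L_C$ be the lattice of $C$-cozero sets, ordered by inclusion. Corollary 3.9. (a) If $C$ is a constructible $\ell$-group and $L_C$ is decidable, then $C$ is decidable. (b) In particular, if $X$ is a perfectly normal Hausdorff space whose lattice of cozero sets $\{f\neq 0\}$, $f\colon X\to\mathbb{R}$ continuous, is decidable, then the $\ell$-group of continuous functions $X\to\mathbb{R}$ is decidable. -/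

import Mathlib

open scoped FirstOrder

universe u v

/-! ### Gödel numbering of sentences and decidable structures -/

/-- Gödel number of a term in the variables `0, …, n - 1`: the `i`-th variable gets `2 * i`, the
term `f(t₁, …, t_k)` gets `2 * ⟨number of f, number of the list of the codes of t₁, …, t_k⟩ + 1`. -/
def termCode {L : FirstOrder.Language.{u, v}} [∀ k, Encodable (L.Functions k)] {n : ℕ} :
    L.Term (Empty ⊕ Fin n) → ℕ
  | .var (.inl e) => e.elim
  | .var (.inr i) => 2 * (i : ℕ)
  | .func f ts =>
      2 * Nat.pair (Encodable.encode f)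
        (Encodable.encode (List.ofFn fun i => termCode (ts i))) + 1

/-- Gödel number of a first-order formula whose free variables are among the variables
`0, …, n - 1`; if `φ` has its free variables among `0, …, n`, then the quantifier in `φ.all` binds
the variable `n`. -/
def formulaCode {L : FirstOrder.Language.{u, v}} [∀ k, Encodable (L.Functions k)]
    [∀ k, Encodable (L.Relations k)] : {n : ℕ} → L.BoundedFormula Empty n → ℕ
  | _, .falsum => Nat.pair 0 0
  | _, .equal s t => Nat.pair 1 (Nat.pair (termCode s) (termCode t))
  | _, .rel R ts =>
      Nat.pair 2 (Nat.pair (Encodable.encode R)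
        (Encodable.encode (List.ofFn fun i => termCode (ts i))))
  | _, .imp φ ψ => Nat.pair 3 (Nat.pair (formulaCode φ) (formulaCode ψ))
  | _, .all φ => Nat.pair 4 (formulaCode φ)

/-- The `L`-structure `S` is decidable: there is an algorithm which, given (the Gödel number of) an
`L`-sentence, decides whether the sentence is true in `S`. (The values of the algorithm at numbers
that are not Gödel numbers of sentences are irrelevant, since being such a number can be checked
effectively.) -/
def IsDecidableStructure (L : FirstOrder.Language.{u, v}) [∀ k, Encodable (L.Functions k)]
    [∀ k, Encodable (L.Relations k)] (S : Type*) [L.Structure S] : Prop :=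
  ∃ algorithm : ℕ → Bool, Computable algorithm ∧
    ∀ φ : L.Sentence, algorithm (formulaCode φ) = true ↔ S ⊨ φ

/-! ### The language `{≤}` -/

instance orderFunctionsEncodable (k : ℕ) : Encodable (FirstOrder.Language.order.Functions k) :=
  inferInstanceAs (Encodable Empty)

/-- The relation symbol `≤` has number `0`. -/
instance orderRelationsEncodable (k : ℕ) : Encodable (FirstOrder.Language.order.Relations k) :=
  Encodable.ofLeftInjection (fun _ => (0 : ℕ))
    (fun _ => match k with
      | 2 => some FirstOrder.Language.orderRel.le
      | _ => none)
    (fun R => by cases R; rfl)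

/-! ### The language `{+, -, (q · _ | q ∈ ℚ), ≤}` of divisible abelian `ℓ`-groups -/

/-- Function symbols: binary `+`, binary `-`, and for each `q ∈ ℚ` a unary symbol for
multiplication by `q`. -/
inductive DivLGroupFunc : ℕ → Type
  | add : DivLGroupFunc 2
  | sub : DivLGroupFunc 2
  | smul (q : ℚ) : DivLGroupFunc 1

/-- Relation symbols: binary `≤`. -/
inductive DivLGroupRel : ℕ → Type
  | le : DivLGroupRel 2

/-- The first-order language `{+, -, (q · _ | q ∈ ℚ), ≤}`. -/
def divLGroupLanguage : FirstOrder.Language.{0, 0} := ⟨DivLGroupFunc, DivLGroupRel⟩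

/-- The numbers of the function symbols; the symbol of `q = a / b` (in lowest terms) has number
`⟨number of a, b⟩`. -/
def DivLGroupFunc.code : {k : ℕ} → DivLGroupFunc k → ℕ
  | _, .add => 0
  | _, .sub => 1
  | _, .smul q => Nat.pair (Encodable.encode q.num) q.den

/-- The `k`-ary function symbol with a given number, if there is one. -/
def DivLGroupFunc.ofCode : (k : ℕ) → ℕ → Option (DivLGroupFunc k)
  | 1, c => (Encodable.decode (α := ℤ) c.unpair.1).map fun a : ℤ => .smul ((a : ℚ) / (c.unpair.2 : ℚ))
  | 2, 0 => some .add
  | 2, 1 => some .sub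
  | _, _ => none

instance divLGroupFunctionsEncodable (k : ℕ) : Encodable (divLGroupLanguage.Functions k) :=
  Encodable.ofLeftInjection (α := ℕ) DivLGroupFunc.code (DivLGroupFunc.ofCode k)
    (fun f => by
      cases f with
      | add => rfl
      | sub => rfl
      | smul q =>
        simp only [DivLGroupFunc.code, DivLGroupFunc.ofCode, Nat.unpair_pair, Encodable.encodek,
          Option.map_some, Rat.num_div_den]
        rfl)

/-- The relation symbol `≤` has number `0`. -/
instance divLGroupRelationsEncodable (k : ℕ) : Encodable (divLGroupLanguage.Relations k) :=
  Encodable.ofLeftInjection (fun _ => (0 : ℕ))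
    (fun _ => match k with
      | 2 => some DivLGroupRel.le
      | _ => none)
    (fun R => by cases R; rfl)

/-! ### Constructible `ℓ`-groups -/

section ConstructibleLGroup

variable {X : Type u} {M : Type v}

/-- `Z` is the zero set `{f = 0}` of some `f ∈ C`. -/
def IsZeroSetOf [Zero M] (C : Set (X → M)) (Z : Set X) : Prop :=
  ∃ f ∈ C, Z = {x | f x = 0}

/-- `U` is the complement of a zero set of some `f ∈ C`. -/
def IsCozeroSetOf [Zero M] (C : Set (X → M)) (U : Set X) : Prop :=
  IsZeroSetOf C Uᶜ

/-- The poset of `C`-cozero sets, ordered by inclusion. -/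
def CozeroSets [Zero M] (C : Set (X → M)) : Type u :=
  {U : Set X // IsCozeroSetOf C U}

instance cozeroSetsPartialOrder [Zero M] (C : Set (X → M)) : PartialOrder (CozeroSets C) :=
  inferInstanceAs (PartialOrder {U : Set X // IsCozeroSetOf C U})

instance cozeroSetsOrderStructure [Zero M] (C : Set (X → M)) :
    FirstOrder.Language.order.Structure (CozeroSets C) :=
  FirstOrder.Language.orderStructure _

/-- Boolean combinations of `C`-zero sets. -/
def IsConstructibleSetOf [Zero M] (C : Set (X → M)) (Z : Set X) : Prop :=
  Z ∈ BooleanSubalgebra.closure {A : Set X | IsZeroSetOf C A}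

/-- `Z` is a `C`-constructible set and the restriction of `g` to `Z` is a `C`-constructible
function `Z → M`. (Every function `Z → M` is the restriction of some `g : X → M`.) -/
def IsConstructibleFunOn [Zero M] (C : Set (X → M)) (g : X → M) (Z : Set X) : Prop :=
  IsConstructibleSetOf C Z ∧
    ∃ (n : ℕ) (A : Fin n → Set X) (f : Fin n → X → M),
      (∀ i, IsConstructibleSetOf C (A i)) ∧ Z = ⋃ i, A i ∧
      (∀ i, f i ∈ C) ∧ ∀ i, Set.EqOn g (f i) (A i)

/-- `C` is a constructible `ℓ`-group of continuous functions `X → M`: a `ℚ`-vector sublattice of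
`M^X` consisting of continuous functions and satisfying the zero set property, the closure
property, the Tietze extension property and glueing over closed sets. -/
structure IsConstructibleLGroup [TopologicalSpace X] [AddCommGroup M] [LinearOrder M]
    [Module ℚ M] [TopologicalSpace M] (C : Submodule ℚ (X → M)) : Prop where
  continuous_of_mem : ∀ f ∈ C, Continuous f
  sup_mem : ∀ f ∈ C, ∀ g ∈ C, f ⊔ g ∈ C
  inf_mem : ∀ f ∈ C, ∀ g ∈ C, f ⊓ g ∈ C
  zeroSet : ∀ A : Set X, IsClosed A → IsConstructibleSetOf (C : Set (X → M)) A →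
    IsZeroSetOf (C : Set (X → M)) A
  closure_cozeroSet : ∀ U : Set X, IsCozeroSetOf (C : Set (X → M)) U →
    IsConstructibleSetOf (C : Set (X → M)) (closure U)
  tietze : ∀ (A : Set X) (g : X → M), IsClosed A → ContinuousOn g A →
    IsConstructibleFunOn (C : Set (X → M)) g A → ∃ f ∈ C, Set.EqOn f g A
  glue : ∀ (n : ℕ) (A : Fin n → Set X) (f : X → M), (∀ i, IsClosed (A i)) →
    (⋃ i, A i) = Set.univ → (∀ i, ContinuousOn f (A i)) →
    (∀ i, IsConstructibleFunOn (C : Set (X → M)) f (A i)) → f ∈ C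

/-- The `ℓ`-group `C`, with pointwise operations and pointwise order, as a structure in the
language `{+, -, (q · _ | q ∈ ℚ), ≤}`. -/
instance divLGroupStructure [AddCommGroup M] [LinearOrder M] [Module ℚ M]
    (C : Submodule ℚ (X → M)) : divLGroupLanguage.Structure C where
  funMap := fun {_} F =>
    match F with
    | DivLGroupFunc.add => fun a => a 0 + a 1
    | DivLGroupFunc.sub => fun a => a 0 - a 1
    | DivLGroupFunc.smul q => fun a => q • a 0
  RelMap := fun {_} R =>
    match R with
    | DivLGroupRel.le => fun a => a 0 ≤ a 1

end ConstructibleLGroup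

/-! The proof is an effective translation of `ℓ`-group formulas into lattice formulas. For
`ℚ`-linear terms, `t ≤ s` holds iff `{s < t}` is empty, and clearing denominators turns this set
into `{p < r}` for linear forms `p`, `r` with coefficients in `ℕ`. A tuple `f_0, …, f_{n-1}` is
therefore replaced by a finite table of cozero sets `{p(f) < r(f)}`, and a quantifier over `f_n` by
a quantifier over those tables of the next depth that come from some `f_n`.

Which tables do so is decided by Fourier–Motzkin elimination. If two forms have coefficients of
opposite sign at `f_n`, a positive combination of them is free of `f_n`, so its sign is recorded in
the old table. This gives inclusions `A ∩ D ⊆ B ∪ E` between old and new sets. They are necessary by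
`Represents.quadHolds` and sufficient by `Represents.exists_of_quadHolds`.

Sufficiency rests on `IsConstructibleLGroup.exists_cut`. Dividing by the coefficient of `f_n`, the
table says where the unknown `f` lies below, on and above finitely many given functions `t i`. Where
`f` must equal some `t i`, the values fit together and extend by the Tietze property. Elsewhere `f`
must lie in an open interval between a maximum and a minimum of given functions. A lattice
expression does both on each of finitely many closed pieces, and glueing finishes.

Only forms below an explicit bound matter, so the translation is primitive recursive in the Gödel
number, and `exists_translation` shows by induction on the formula that it preserves truth. The
second part follows because the continuous real functions on a perfectly normal space form a
constructible `ℓ`-group. -/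

theorem half_between {M : Type v} [AddCommGroup M] [LinearOrder M] [IsOrderedAddMonoid M]
    [Module ℚ M] {a b : M} (h : a < b) :
    a < (1 / 2 : ℚ) • (a + b) ∧ (1 / 2 : ℚ) • (a + b) < b := by
  set m := (1 / 2 : ℚ) • (a + b) with hm
  -- Doubling avoids any compatibility of the `ℚ`-action with the order; only the ordered group
  -- structure is used.
  have h2 : m + m = a + b := by
    rw [hm, ← add_smul]; norm_num
  constructor
  · by_contra hc
    have := add_le_add (not_lt.1 hc) (not_lt.1 hc)
    rw [h2] at this
    exact absurd (le_of_add_le_add_left this) (not_le.2 h)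
  · by_contra hc
    have := add_le_add (not_lt.1 hc) (not_lt.1 hc)
    rw [h2] at this
    exact absurd (le_of_add_le_add_right this) (not_le.2 h)

/-! ### Constructible sets, and functions with prescribed position relative to finitely many others
-/

section Topology

variable {X : Type u} {M : Type v}

theorem IsConstructibleSetOf.compl [Zero M] {C : Set (X → M)} {A : Set X}
    (h : IsConstructibleSetOf C A) : IsConstructibleSetOf C Aᶜ :=
  BooleanSubalgebra.compl_mem h

theorem IsConstructibleSetOf.union [Zero M] {C : Set (X → M)} {A B : Set X}
    (hA : IsConstructibleSetOf C A) (hB : IsConstructibleSetOf C B) :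
    IsConstructibleSetOf C (A ∪ B) :=
  (BooleanSubalgebra.closure _).supClosed hA hB

theorem IsConstructibleSetOf.iUnion [Zero M] {C : Set (X → M)} {ι : Type*} [Finite ι]
    {A : ι → Set X} (hA : ∀ i, IsConstructibleSetOf C (A i)) :
    IsConstructibleSetOf C (⋃ i, A i) := by
  classical
  have := Fintype.ofFinite ι
  have key : ∀ s : Finset ι, IsConstructibleSetOf C (⋃ i ∈ s, A i) := by
    intro s
    induction s using Finset.induction_on with
    | empty => simpa [IsConstructibleSetOf] using (BooleanSubalgebra.bot_mem :
        (⊥ : Set X) ∈ BooleanSubalgebra.closure {A : Set X | IsZeroSetOf C A})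
    | insert a s ha ih =>
      rw [Finset.set_biUnion_insert]
      exact (hA a).union ih
  simpa using key Finset.univ

theorem IsConstructibleSetOf.iInter [Zero M] {C : Set (X → M)} {ι : Type*} [Finite ι]
    {A : ι → Set X} (hA : ∀ i, IsConstructibleSetOf C (A i)) :
    IsConstructibleSetOf C (⋂ i, A i) := by
  have := (IsConstructibleSetOf.iUnion fun i => (hA i).compl).compl
  simpa [Set.compl_iUnion] using this

theorem IsCozeroSetOf.constructible [Zero M] {C : Set (X → M)} {U : Set X}
    (hU : IsCozeroSetOf C U) : IsConstructibleSetOf C U := by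
  have h : IsConstructibleSetOf C Uᶜ := BooleanSubalgebra.mem_closure_of_mem hU
  simpa using h.compl

variable [TopologicalSpace X] [AddCommGroup M] [LinearOrder M]
  [Module ℚ M] [TopologicalSpace M] {C : Submodule ℚ (X → M)}

theorem IsConstructibleLGroup.abs_mem (hC : IsConstructibleLGroup C) {f : X → M} (hf : f ∈ C) :
    (fun x => |f x|) ∈ C :=
  hC.sup_mem f hf (-f) (C.neg_mem hf)

/-- The base function `b` covers the empty family. Recording that the maximum is attained at each
point allows strict inequalities to be checked one function at a time. -/
theorem IsConstructibleLGroup.exists_finset_max (hC : IsConstructibleLGroup C) {ι : Type*}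
    (s : Finset ι) {t : ι → X → M} (ht : ∀ i, t i ∈ C) {b : X → M} (hb : b ∈ C) :
    ∃ L ∈ C, ∀ x, b x ≤ L x ∧ (∀ i ∈ s, t i x ≤ L x) ∧ (L x = b x ∨ ∃ i ∈ s, L x = t i x) := by
  classical
  induction s using Finset.induction_on with
  | empty => exact ⟨b, hb, fun x => by simp⟩
  | insert a s ha ih =>
    obtain ⟨L, hL, h⟩ := ih
    refine ⟨L ⊔ t a, hC.sup_mem _ hL _ (ht a), fun x => ⟨(h x).1.trans le_sup_left, ?_, ?_⟩⟩
    · intro i hi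
      rcases Finset.mem_insert.1 hi with rfl | hi
      · exact le_sup_right
      · exact ((h x).2.1 i hi).trans le_sup_left
    · rcases le_total (L x) (t a x) with h' | h'
      · exact .inr ⟨a, by simp, by simpa using h'⟩
      · have : (L ⊔ t a) x = L x := by simpa using h'
        rw [this]
        rcases (h x).2.2 with h'' | ⟨i, hi, h''⟩
        · exact .inl h''
        · exact .inr ⟨i, by simp [hi], h''⟩

theorem IsConstructibleLGroup.exists_finset_min [IsOrderedAddMonoid M] (hC : IsConstructibleLGroup C) {ι : Type*}
    (s : Finset ι) {t : ι → X → M} (ht : ∀ i, t i ∈ C) {b : X → M} (hb : b ∈ C) :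
    ∃ R ∈ C, ∀ x, R x ≤ b x ∧ (∀ i ∈ s, R x ≤ t i x) ∧ (R x = b x ∨ ∃ i ∈ s, R x = t i x) := by
  obtain ⟨L, hL, h⟩ := hC.exists_finset_max s (t := fun i => -t i) (fun i => C.neg_mem (ht i))
    (C.neg_mem hb)
  refine ⟨-L, C.neg_mem hL, fun x => ⟨neg_le.1 (h x).1, fun i hi => neg_le.1 ((h x).2.1 i hi), ?_⟩⟩
  rcases (h x).2.2 with h' | ⟨i, hi, h'⟩
  · exact .inl (by simp [h'])
  · exact .inr ⟨i, hi, by simp [h']⟩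

variable [OrderTopology M]

theorem IsConstructibleLGroup.isClosed_compl (hC : IsConstructibleLGroup C) {U : Set X}
    (hU : IsCozeroSetOf (C : Set (X → M)) U) : IsClosed Uᶜ := by
  obtain ⟨f, hf, h⟩ := hU
  rw [h]
  exact isClosed_eq (hC.continuous_of_mem f hf) continuous_const

/-- A family of pairs of cozero sets that is consistent with the order relations between the
functions `t i` consists of the sets `{f < t i}`, `{t i < f}` for some `f`. -/
theorem IsConstructibleLGroup.exists_cut [IsOrderedAddMonoid M] (hC : IsConstructibleLGroup C) {J : Type*} [Finite J]
    {t : J → X → M} (ht : ∀ i, t i ∈ C) {Lo Hi : J → Set X}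
    (hLo : ∀ i, IsCozeroSetOf (C : Set (X → M)) (Lo i))
    (hHi : ∀ i, IsCozeroSetOf (C : Set (X → M)) (Hi i))
    (h1 : ∀ i x, x ∈ Lo i → x ∉ Hi i)
    (h2 : ∀ i j x, t j x < t i x → x ∈ Lo i ∨ x ∈ Hi j)
    (h3 : ∀ i j x, x ∈ Lo j → x ∈ Lo i ∨ t i x < t j x)
    (h4 : ∀ i j x, x ∈ Hi i → x ∈ Hi j ∨ t i x < t j x) :
    ∃ f ∈ C, ∀ i, Lo i = {x | f x < t i x} ∧ Hi i = {x | t i x < f x} := by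
  classical
  have := Fintype.ofFinite J
  -- the closed set where `f` is prescribed
  let A : J → Set X := fun i => (Lo i)ᶜ ∩ (Hi i)ᶜ
  have hAcl : ∀ i, IsClosed (A i) := fun i =>
    (hC.isClosed_compl (hLo i)).inter (hC.isClosed_compl (hHi i))
  have hAcons : ∀ i, IsConstructibleSetOf (C : Set (X → M)) (A i) := fun i => by
    have := ((hLo i).constructible.union (hHi i).constructible).compl
    rwa [Set.compl_union] at this
  -- By `h2` a strict inequality between `t i` and `t j` at `x` would put `x` into one of the sets
  -- that `A i` and `A j` avoid.
  have hAeq : ∀ i j x, x ∈ A i → x ∈ A j → t i x = t j x := by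
    intro i j x hi hj
    refine le_antisymm (not_lt.1 fun h => ?_) (not_lt.1 fun h => ?_)
    · rcases h2 i j x h with h | h
      · exact hi.1 h
      · exact hj.2 h
    · rcases h2 j i x h with h | h
      · exact hj.1 h
      · exact hi.2 h
  have hUcl : IsClosed (⋃ i, A i) := isClosed_iUnion_of_finite hAcl
  have hUcons : IsConstructibleSetOf (C : Set (X → M)) (⋃ i, A i) :=
    IsConstructibleSetOf.iUnion hAcons
  -- `|h|` vanishes exactly where `f` is prescribed; elsewhere it supplies the positive slack for
  -- strict inequalities.
  obtain ⟨h, hhC, hhA⟩ := hC.zeroSet _ hUcl hUcons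
  let g₀ : X → M := fun x => if hx : ∃ i, x ∈ A i then t hx.choose x else 0
  have hg₀ : ∀ i, Set.EqOn g₀ (t i) (A i) := by
    intro i x hx
    have hex : ∃ i, x ∈ A i := ⟨i, hx⟩
    simp only [g₀, dif_pos hex]
    exact hAeq _ _ _ hex.choose_spec hx
  obtain ⟨g, hgC, hgA⟩ : ∃ g ∈ C, ∀ i, Set.EqOn g (t i) (A i) := by
    obtain ⟨e⟩ : Nonempty (J ≃ Fin (Fintype.card J)) := ⟨Fintype.equivFin J⟩
    obtain ⟨g, hg, hgA⟩ := hC.tietze (⋃ i, A i) g₀ hUcl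
      ((locallyFinite_of_finite A).continuousOn_iUnion hAcl fun i =>
        ((hC.continuous_of_mem _ (ht i)).continuousOn).congr (hg₀ i))
      ⟨hUcons, Fintype.card J, fun i => A (e.symm i), fun i => t (e.symm i),
        fun i => hAcons _, (e.symm.surjective.iUnion_comp A).symm, fun i => ht _,
        fun i => hg₀ _⟩
    exact ⟨g, hg, fun i x hx => (hgA (Set.mem_iUnion.2 ⟨i, hx⟩)).trans (hg₀ i hx)⟩
  have hh0 : ∀ x, h x = 0 ↔ ∃ i, x ∈ A i := fun x => by
    rw [← Set.mem_iUnion, hhA, Set.mem_ofPred_eq]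
  -- a common bound
  obtain ⟨b, hbC, hb⟩ : ∃ b ∈ C, ∀ x, |g x| + |h x| ≤ b x ∧ ∀ i, |t i x| + |h x| ≤ b x := by
    obtain ⟨L, hL, h'⟩ := hC.exists_finset_max Finset.univ
      (t := fun i x => |t i x|) (fun i => hC.abs_mem (ht i)) (hC.abs_mem hgC)
    exact ⟨L + fun x => |h x|, C.add_mem hL (hC.abs_mem hhC), fun x =>
      ⟨add_le_add_left (h' x).1 _, fun i => add_le_add_left ((h' x).2.1 i (Finset.mem_univ i)) _⟩⟩
  -- the pieces
  let B : Finset J → Set X := fun S => ⋂ i, if i ∈ S then (Hi i)ᶜ else (Lo i)ᶜ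
  have hBcl : ∀ S, IsClosed (B S) := fun S => isClosed_iInter fun i => by
    split_ifs
    · exact hC.isClosed_compl (hHi i)
    · exact hC.isClosed_compl (hLo i)
  have hBcons : ∀ S, IsConstructibleSetOf (C : Set (X → M)) (B S) := fun S =>
    IsConstructibleSetOf.iInter fun i => by
      split_ifs
      · exact (hHi i).constructible.compl
      · exact (hLo i).constructible.compl
  have hBin : ∀ S i x, x ∈ B S → i ∈ S → x ∉ Hi i := fun S i x hx hi => by
    simpa [hi] using Set.mem_iInter.1 hx i
  have hBout : ∀ S i x, x ∈ B S → i ∉ S → x ∉ Lo i := fun S i x hx hi => by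
    simpa [hi] using Set.mem_iInter.1 hx i
  have piece : ∀ S : Finset J, ∃ f ∈ C, ∀ x ∈ B S, ((∃ i, x ∈ A i) → f x = g x) ∧
      ((¬ ∃ i, x ∈ A i) → ∀ i, (i ∈ S → f x < t i x) ∧ (i ∉ S → t i x < f x)) := by
    intro S
    -- On `B S` the graph of `f` has to stay between `L` and `R`; `-b` and `b` are the ends when
    -- there is no `t i` on that side.
    obtain ⟨L, hL, hL'⟩ := hC.exists_finset_max Sᶜ ht (C.neg_mem hbC)
    obtain ⟨R, hR, hR'⟩ := hC.exists_finset_min S ht hbC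
    let m : X → M := (1 / 2 : ℚ) • (L + R)
    have hm : m ∈ C := C.smul_mem _ (C.add_mem hL hR)
    let a : X → M := fun x => |h x|
    have ha : a ∈ C := hC.abs_mem hhC
    -- This clamps `g` between `L + a` and `R - a`, cut off at the midpoint `m` so that the two
    -- bounds never cross. For `a = 0` one has `L ≤ g ≤ R` and the value is `g`; for `a > 0` one has
    -- `L < R` and the value lies strictly between them.
    refine ⟨((L + a) ⊓ m) ⊔ (g ⊓ ((R - a) ⊔ m)), hC.sup_mem _ (hC.inf_mem _ (C.add_mem hL ha) _ hm)
      _ (hC.inf_mem _ hgC _ (hC.sup_mem _ (C.sub_mem hR ha) _ hm)), fun x hx => ⟨?_, ?_⟩⟩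
    · rintro ⟨k, hk⟩
      have hax : a x = 0 := by simp [a, (hh0 x).2 ⟨k, hk⟩]
      have hgx : g x = t k x := hgA k hk
      have hhx : h x = 0 := (hh0 x).2 ⟨k, hk⟩
      have hgb : |g x| ≤ b x := by simpa [hhx] using (hb x).1
      have hLg : L x ≤ g x := by
        rcases (hL' x).2.2 with e | ⟨i, hi, e⟩
        · rw [e]; exact (abs_le.1 hgb).1
        · rw [e, hgx]
          refine not_lt.1 fun hlt => ?_
          rcases h2 i k x hlt with h' | h'
          · exact hBout S i x hx (Finset.mem_compl.1 hi) h'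
          · exact hk.2 h'
      have hgR : g x ≤ R x := by
        rcases (hR' x).2.2 with e | ⟨i, hi, e⟩
        · rw [e]; exact (abs_le.1 hgb).2
        · rw [e, hgx]
          refine not_lt.1 fun hlt => ?_
          rcases h2 k i x hlt with h' | h'
          · exact hk.1 h'
          · exact hBin S i x hx hi h'
      have hmL : (L x ⊓ m x) ≤ g x := inf_le_left.trans hLg
      have hmR : g x ≤ R x ⊔ m x := hgR.trans le_sup_left
      simp only [Pi.sup_apply, Pi.inf_apply, Pi.add_apply, Pi.sub_apply, hax, add_zero, sub_zero]
      rw [inf_eq_left.2 hmR, sup_eq_right.2 hmL]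
    · intro hA
      have hpos : 0 < a x := abs_pos.2 fun h0 => hA ((hh0 x).1 h0)
      have hmemS : ∀ i ∈ S, x ∈ Lo i := fun i hi => by
        by_contra hc
        exact hA ⟨i, hc, hBin S i x hx hi⟩
      have hmemS' : ∀ i ∉ S, x ∈ Hi i := fun i hi => by
        by_contra hc
        exact hA ⟨i, hBout S i x hx hi, hc⟩
      have htb : ∀ i, |t i x| < b x := fun i =>
        lt_of_lt_of_le (lt_add_of_pos_right _ hpos) ((hb x).2 i)
      have hb0 : 0 < b x :=
        lt_of_lt_of_le (add_pos_of_nonneg_of_pos (abs_nonneg (g x)) hpos) (hb x).1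
      have hLR : L x < R x := by
        rcases (hL' x).2.2 with e | ⟨i, hi, e⟩ <;> rcases (hR' x).2.2 with e' | ⟨j, hj, e'⟩ <;>
          rw [e, e']
        · exact (neg_lt_zero.2 hb0).trans hb0
        · exact (abs_lt.1 (htb j)).1
        · exact (abs_lt.1 (htb i)).2
        · rcases h3 i j x (hmemS j hj) with h' | h'
          · exact absurd h' (hBout S i x hx (Finset.mem_compl.1 hi))
          · exact h'
      obtain ⟨hm1, hm2⟩ := half_between hLR
      have hmx : m x = (1 / 2 : ℚ) • (L x + R x) := rfl
      rw [← hmx] at hm1 hm2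
      set f : X → M := ((L + a) ⊓ m) ⊔ (g ⊓ ((R - a) ⊔ m)) with hf
      have hLf : L x < f x :=
        lt_of_lt_of_le (lt_inf_iff.2 ⟨lt_add_of_pos_right _ hpos, hm1⟩) le_sup_left
      have hfR : f x < R x := sup_lt_iff.2 ⟨lt_of_le_of_lt inf_le_right hm2,
        lt_of_le_of_lt inf_le_right (sup_lt_iff.2 ⟨sub_lt_self _ hpos, hm2⟩)⟩
      exact fun i => ⟨fun hi => hfR.trans_le ((hR' x).2.1 i hi),
        fun hi => ((hL' x).2.1 i (Finset.mem_compl.2 hi)).trans_lt hLf⟩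
  choose F hFC hF using piece
  -- A canonical piece containing `x`. Off the sets `A i` it is the only piece containing `x`, and
  -- on them every piece gives the value `g x`, so `f` is independent of the choice.
  let σ : X → Finset J := fun x => Finset.univ.filter fun i => x ∈ Lo i
  have hσ : ∀ x, x ∈ B (σ x) := fun x => Set.mem_iInter.2 fun i => by
    by_cases hi : x ∈ Lo i
    · simpa [σ, hi] using h1 i x hi
    · simp [σ, hi]
  let f : X → M := fun x => F (σ x) x
  have hfF : ∀ S, Set.EqOn f (F S) (B S) := by
    intro S x hx
    by_cases hA : ∃ i, x ∈ A i
    · exact ((hF _ x (hσ x)).1 hA).trans ((hF S x hx).1 hA).symm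
    · have : S = σ x := by
        ext i
        simp only [σ, Finset.mem_filter, Finset.mem_univ, true_and]
        constructor
        · intro hi
          by_contra hc
          exact hA ⟨i, hc, hBin S i x hx hi⟩
        · intro hi
          by_contra hc
          exact hBout S i x hx hc hi
      rw [this]
  have hfC : f ∈ C := by
    obtain ⟨e⟩ : Nonempty (Finset J ≃ Fin (Fintype.card (Finset J))) := ⟨Fintype.equivFin _⟩
    refine hC.glue (Fintype.card (Finset J)) (fun k => B (e.symm k)) f (fun k => hBcl _) ?_ ?_ ?_
    · rw [e.symm.surjective.iUnion_comp B]
      exact Set.eq_univ_of_forall fun x => Set.mem_iUnion.2 ⟨σ x, hσ x⟩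
    · exact fun k => (hC.continuous_of_mem _ (hFC _)).continuousOn.congr (hfF _)
    · exact fun k => ⟨hBcons _, 1, fun _ => B (e.symm k), fun _ => F (e.symm k), fun _ => hBcons _,
        (Set.iUnion_const _).symm, fun _ => hFC _, fun _ => hfF _⟩
  refine ⟨f, hfC, fun i => ?_⟩
  have key : ∀ x, (x ∈ Lo i ↔ f x < t i x) ∧ (x ∈ Hi i ↔ t i x < f x) := by
    intro x
    by_cases hA : ∃ k, x ∈ A k
    · obtain ⟨k, hk⟩ := hA
      have hfx : f x = t k x := ((hF _ x (hσ x)).1 ⟨k, hk⟩).trans (hgA k hk)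
      rw [hfx]
      -- On `A k`, where `f = t k`, conditions `h2`, `h3`, `h4` say exactly that `Lo i` and `Hi i`
      -- record the comparison of `t k` with `t i`.
      exact ⟨⟨fun hi => (h3 k i x hi).resolve_left hk.1, fun hi => (h2 i k x hi).resolve_right hk.2⟩,
        ⟨fun hi => (h4 i k x hi).resolve_left hk.2, fun hi => (h2 k i x hi).resolve_left hk.1⟩⟩
    · have hi := (hF _ x (hσ x)).2 hA i
      have hmem : i ∈ σ x ↔ x ∈ Lo i := by simp [σ]
      by_cases hx : x ∈ Lo i
      · have hlt := hi.1 (hmem.2 hx)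
        exact ⟨iff_of_true hx hlt, iff_of_false (h1 i x hx) hlt.not_gt⟩
      · have hlt := hi.2 (mt hmem.1 hx)
        refine ⟨iff_of_false hx hlt.not_gt, iff_of_true ?_ hlt⟩
        by_contra hc
        exact hA ⟨i, hx, hc⟩
  exact ⟨Set.ext fun x => (key x).1, Set.ext fun x => (key x).2⟩

end Topology

/-- In a perfectly normal space every closed set is a zero set, which settles both conditions on
sets; extension is Tietze's theorem, and glueing is continuity on a finite closed cover. -/
theorem isConstructibleLGroup_continuousSubmodule (X : Type u) [TopologicalSpace X]
    [PerfectlyNormalSpace X] : IsConstructibleLGroup (continuousSubmodule X ℚ ℝ) := by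
  have hzero : ∀ A : Set X, IsClosed A →
      IsZeroSetOf (continuousSubmodule X ℚ ℝ : Set (X → ℝ)) A := by
    intro A hA
    obtain ⟨f, hf, -⟩ := perfectlyNormalSpace_iff_forall_isClosed_preimage_zero.1 ‹_› A hA
    exact ⟨f, f.continuous, hf⟩
  refine ⟨fun f hf => hf, fun f hf g hg => Continuous.sup hf hg, fun f hf g hg =>
    Continuous.inf hf hg, fun A hA _ => hzero A hA, fun U _ => ?_, ?_, ?_⟩
  · exact BooleanSubalgebra.mem_closure_of_mem (hzero _ isClosed_closure)
  · intro A g hA hg _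
    obtain ⟨f, hf⟩ := ContinuousMap.exists_restrict_eq hA ⟨A.domRestrict g, hg.domRestrict⟩
    exact ⟨f, f.continuous, fun x hx => congrArg (fun k => k ⟨x, hx⟩) hf⟩
  · intro n A f hA hU hf _
    have := (locallyFinite_of_finite A).continuousOn_iUnion hA hf
    rw [hU] at this
    exact continuousOn_univ.1 this

/-! ### Computing the translation -/

section Coding

open Primrec

/-- The list `a * p + b * q`, coordinates beyond the length of a list being `0`. -/
def comb (a : ℕ) (p : List ℕ) (b : ℕ) (q : List ℕ) : List ℕ :=
  (List.range (p.length + q.length)).map fun i => a * p.getD i 0 + b * q.getD i 0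

theorem comb_getD (a : ℕ) (p : List ℕ) (b : ℕ) (q : List ℕ) (i : ℕ) :
    (comb a p b q).getD i 0 = a * p.getD i 0 + b * q.getD i 0 := by
  by_cases hi : i < p.length + q.length
  · simp [comb, List.getD_eq_getElem?_getD, hi]
  · have h1 : p.length ≤ i := by omega
    have h2 : q.length ≤ i := by omega
    have h3 : (comb a p b q).length ≤ i := by simp [comb]; omega
    rw [List.getD_eq_default _ _ h1, List.getD_eq_default _ _ h2, List.getD_eq_default _ _ h3]
    simp

variable {α : Type*} [Primcodable α]

theorem Primrec.natAdd {f g : α → ℕ} (hf : Primrec f) (hg : Primrec g) :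
    Primrec fun x => f x + g x := nat_add.comp hf hg

theorem Primrec.natSub {f g : α → ℕ} (hf : Primrec f) (hg : Primrec g) :
    Primrec fun x => f x - g x := nat_sub.comp hf hg

theorem Primrec.natMul {f g : α → ℕ} (hf : Primrec f) (hg : Primrec g) :
    Primrec fun x => f x * g x := nat_mul.comp hf hg

theorem Primrec.natSq {f : α → ℕ} (hf : Primrec f) : Primrec fun x => f x ^ 2 :=
  (hf.natMul hf).of_eq fun _ => (sq _).symm

theorem Primrec.natPair {f g : α → ℕ} (hf : Primrec f) (hg : Primrec g) :
    Primrec fun x => Nat.pair (f x) (g x) := Primrec₂.natPair.comp hf hg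

theorem Primrec.unpairFst {f : α → ℕ} (hf : Primrec f) : Primrec fun x => (f x).unpair.1 :=
  fst.comp (unpair.comp hf)

theorem Primrec.unpairSnd {f : α → ℕ} (hf : Primrec f) : Primrec fun x => (f x).unpair.2 :=
  snd.comp (unpair.comp hf)

theorem Primrec.getD {f : α → List ℕ} {g : α → ℕ} (hf : Primrec f) (hg : Primrec g) :
    Primrec fun x => (f x).getD (g x) 0 := (list_getD 0).comp hf hg

theorem Primrec.listCons {β : Type*} [Primcodable β] {f : α → β} {g : α → List β}
    (hf : Primrec f) (hg : Primrec g) : Primrec fun x => f x :: g x := list_cons.comp hf hg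

theorem Primrec.comb {a b : α → ℕ} {p q : α → List ℕ} (ha : Primrec a) (hp : Primrec p)
    (hb : Primrec b) (hq : Primrec q) : Primrec fun x => comb (a x) (p x) (b x) (q x) :=
  list_map (list_range.comp ((list_length.comp hp).natAdd (list_length.comp hq)))
    (((ha.comp fst).natMul ((hp.comp fst).getD snd)).natAdd
      ((hb.comp fst).natMul ((hq.comp fst).getD snd))).to₂

/-- `f 0 + ⋯ + f (n - 1)`. -/
def sumTo (f : ℕ → ℕ) (n : ℕ) : ℕ := Nat.rec 0 (fun k s => s + f k) n

theorem le_sumTo (f : ℕ → ℕ) {k n : ℕ} (h : k < n) : f k ≤ sumTo f n := by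
  induction n with
  | zero => omega
  | succ n ih =>
    change f k ≤ sumTo f n + f n
    rcases Nat.lt_succ_iff_lt_or_eq.1 h with h | rfl
    · exact (ih h).trans (Nat.le_add_right _ _)
    · exact Nat.le_add_left _ _

theorem Primrec.sumTo {f : α → ℕ → ℕ} {g : α → ℕ} (hf : Primrec₂ f) (hg : Primrec g) :
    Primrec fun x => sumTo (f x) (g x) :=
  nat_rec' hg (const 0) ((snd.comp snd).natAdd (hf.comp fst (fst.comp snd))).to₂

/-! #### Terms -/

/-- Common denominator and positive and negative part of the numerators of a linear form with
rational coefficients. -/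
abbrev FormData : Type := ℕ × List ℕ × List ℕ

/-- Integers are numbered with `k` at `2 * k` and `-(k + 1)` at `2 * k + 1`. In the odd case the
sign swaps positive and negative parts, and the absolute value of the numerator is `k + 1`. -/
def smulForm (e : ℕ) (t : FormData) : FormData :=
  if e.unpair.1 % 2 = 0 then
    (e.unpair.2 * t.1, comb (e.unpair.1 / 2) t.2.1 0 [], comb (e.unpair.1 / 2) t.2.2 0 [])
  else
    (e.unpair.2 * t.1, comb (e.unpair.1 / 2 + 1) t.2.2 0 [], comb (e.unpair.1 / 2 + 1) t.2.1 0 [])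

def addForm (t u : FormData) : FormData :=
  (t.1 * u.1, comb u.1 t.2.1 t.1 u.2.1, comb u.1 t.2.2 t.1 u.2.2)

def subForm (t u : FormData) : FormData :=
  (t.1 * u.1, comb u.1 t.2.1 t.1 u.2.2, comb u.1 t.2.2 t.1 u.2.1)

/-- The linear form `f_i`. -/
def varForm (i : ℕ) : FormData := (1, (List.range (i + 1)).map fun j => if j = i then 1 else 0, [])

/-- First entry of a nonempty list with code `e`. -/
def firstArg (e : ℕ) : ℕ := (e - 1).unpair.1

/-- Code of the tail of a nonempty list with code `e`. -/
def restArg (e : ℕ) : ℕ := (e - 1).unpair.2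

theorem firstArg_le (e : ℕ) : firstArg e ≤ e := (Nat.unpair_left_le _).trans (Nat.sub_le _ _)

theorem restArg_le (e : ℕ) : restArg e ≤ e := (Nat.unpair_right_le _).trans (Nat.sub_le _ _)

/-- The linear form of the term with outermost function symbol and arguments given by `e`, from
the linear forms of the arguments. -/
def funcForm (e : ℕ) (t u : FormData) : FormData :=
  -- Symbol numbers are unique only within an arity, so the length of the argument list is tested
  -- first: an empty tail has code `0` and means scalar multiplication.
  if restArg e.unpair.2 = 0 then smulForm e.unpair.1 t
  else if e.unpair.1 = 0 then addForm t u else subForm t u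

/-- The linear form of the term with code `c`. -/
def termForm (c : ℕ) : FormData :=
  if c % 2 = 0 then varForm (c / 2)
  else funcForm (c / 2) (termForm (firstArg (c / 2).unpair.2))
    (termForm (firstArg (restArg (c / 2).unpair.2)))
termination_by c
decreasing_by
  · have := firstArg_le (c / 2).unpair.2
    have := Nat.unpair_right_le (c / 2)
    omega
  · have := firstArg_le (restArg (c / 2).unpair.2)
    have := restArg_le (c / 2).unpair.2
    have := Nat.unpair_right_le (c / 2)
    omega

theorem Primrec.natDiv2 {f : α → ℕ} (hf : Primrec f) : Primrec fun x => f x / 2 :=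
  nat_div.comp hf (const 2)

theorem primrecPred_even {f : α → ℕ} (hf : Primrec f) : PrimrecPred fun x => f x % 2 = 0 :=
  Primrec.eq.comp (nat_mod.comp hf (const 2)) (const 0)

theorem primrec_firstArg {f : α → ℕ} (hf : Primrec f) : Primrec fun x => firstArg (f x) :=
  (hf.natSub (const 1)).unpairFst

theorem primrec_restArg {f : α → ℕ} (hf : Primrec f) : Primrec fun x => restArg (f x) :=
  (hf.natSub (const 1)).unpairSnd

theorem primrec_smulForm {e : α → ℕ} {t : α → FormData} (he : Primrec e) (ht : Primrec t) :
    Primrec fun x => smulForm (e x) (t x) := by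
  have hd := he.unpairSnd.natMul (fst.comp ht)
  have h1 := fst.comp (snd.comp ht)
  have h2 := snd.comp (snd.comp ht)
  have hn := he.unpairFst.natDiv2
  have hn' := hn.natAdd (const 1)
  exact Primrec.ite (primrecPred_even he.unpairFst)
    (hd.pair ((hn.comb h1 (const 0) (const [])).pair (hn.comb h2 (const 0) (const []))))
    (hd.pair ((hn'.comb h2 (const 0) (const [])).pair (hn'.comb h1 (const 0) (const []))))

theorem primrec_addForm {t u : α → FormData} (ht : Primrec t) (hu : Primrec u) :
    Primrec fun x => addForm (t x) (u x) :=
  ((fst.comp ht).natMul (fst.comp hu)).pair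
    (((fst.comp hu).comb (fst.comp (snd.comp ht)) (fst.comp ht) (fst.comp (snd.comp hu))).pair
      ((fst.comp hu).comb (snd.comp (snd.comp ht)) (fst.comp ht) (snd.comp (snd.comp hu))))

theorem primrec_subForm {t u : α → FormData} (ht : Primrec t) (hu : Primrec u) :
    Primrec fun x => subForm (t x) (u x) :=
  ((fst.comp ht).natMul (fst.comp hu)).pair
    (((fst.comp hu).comb (fst.comp (snd.comp ht)) (fst.comp ht) (snd.comp (snd.comp hu))).pair
      ((fst.comp hu).comb (snd.comp (snd.comp ht)) (fst.comp ht) (fst.comp (snd.comp hu))))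

theorem primrec_varForm : Primrec varForm :=
  (const 1).pair ((list_map (list_range.comp succ)
    (Primrec.ite (Primrec.eq.comp snd fst) (const 1) (const 0)).to₂).pair (const []))

theorem primrec_funcForm {e : α → ℕ} {t u : α → FormData} (he : Primrec e) (ht : Primrec t)
    (hu : Primrec u) : Primrec fun x => funcForm (e x) (t x) (u x) :=
  Primrec.ite (Primrec.eq.comp (primrec_restArg he.unpairSnd) (const 0))
    (primrec_smulForm he.unpairFst ht)
    (Primrec.ite (Primrec.eq.comp he.unpairFst (const 0)) (primrec_addForm ht hu)
      (primrec_subForm ht hu))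

/-- Course-of-values recursion: `l c` lists the smaller codes whose values are needed, and `g`
computes the value at `c` from theirs. -/
theorem primrec_termForm : Primrec termForm := by
  let l : ℕ → List ℕ := fun c => if c % 2 = 0 then [] else
    [firstArg (c / 2).unpair.2, firstArg (restArg (c / 2).unpair.2)]
  let d : FormData := (0, [], [])
  let g : ℕ → List FormData → Option FormData := fun c p =>
    some (if c % 2 = 0 then varForm (c / 2) else funcForm (c / 2) (p.getD 0 d) (p.getD 1 d))
  have hl : Primrec l := Primrec.ite (primrecPred_even Primrec.id) (const [])
    ((primrec_firstArg Primrec.id.natDiv2.unpairSnd).listCons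
      ((primrec_firstArg (primrec_restArg Primrec.id.natDiv2.unpairSnd)).listCons (const [])))
  have hg : Primrec₂ g := option_some.comp (Primrec.ite (primrecPred_even fst)
    (primrec_varForm.comp fst.natDiv2)
    (primrec_funcForm fst.natDiv2 ((list_getD d).comp snd (const 0))
      ((list_getD d).comp snd (const 1))))
  refine nat_omega_rec' termForm Primrec.id hl hg ?_ ?_
  · intro c c' hc
    simp only [l] at hc
    split_ifs at hc with h
    · simp at hc
    · have h1 := firstArg_le (c / 2).unpair.2
      have h2 := Nat.unpair_right_le (c / 2)
      have h3 := firstArg_le (restArg (c / 2).unpair.2)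
      have h4 := restArg_le (c / 2).unpair.2
      simp only [List.mem_cons, List.not_mem_nil, or_false] at hc
      simp only [id]
      omega
  · intro c
    rw [termForm]
    by_cases h : c % 2 = 0 <;> simp [g, l, h]

/-! #### Variables -/

/-- For terms `t`, `s` with codes `c`, `d`: the lists `p`, `r` such that `s < t` is equivalent to
`p < r`. -/
def ltForm (c d : ℕ) : List ℕ × List ℕ :=
  (comb (termForm c).1 (termForm d).2.1 (termForm d).1 (termForm c).2.2,
    comb (termForm d).1 (termForm c).2.1 (termForm c).1 (termForm d).2.2)

theorem primrec_ltForm {f g : α → ℕ} (hf : Primrec f) (hg : Primrec g) :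
    Primrec fun x => ltForm (f x) (g x) := by
  have h := primrec_termForm.comp hf
  have h' := primrec_termForm.comp hg
  exact ((fst.comp h).comb (fst.comp (snd.comp h')) (fst.comp h') (snd.comp (snd.comp h))).pair
    ((fst.comp h').comb (fst.comp (snd.comp h)) (fst.comp h) (snd.comp (snd.comp h')))

/-- A bound for the codes of the lists that occur in `ltForm c d` for `c, d ≤ a`. -/
def initBound (a : ℕ) : ℕ :=
  -- A sum serves as a bound for all its terms. Pairs of numbers `≤ a` have codes below `(a + 1) ^
  -- 2`, and the leading `1` makes the bound strict.
  1 + sumTo (fun k => Encodable.encode (ltForm k.unpair.1 k.unpair.2).1 +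
    Encodable.encode (ltForm k.unpair.1 k.unpair.2).2) ((a + 1) ^ 2)

theorem primrec_initBound : Primrec initBound := by
  have h := primrec_ltForm (snd (α := ℕ) (β := ℕ)).unpairFst snd.unpairSnd
  exact (const 1).natAdd (Primrec.sumTo
    ((Primrec.encode.comp (fst.comp h)).natAdd (Primrec.encode.comp (snd.comp h))).to₂
    (succ.natSq))

theorem pair_lt_sq {a b m : ℕ} (ha : a < m) (hb : b < m) : Nat.pair a b < m ^ 2 :=
  (Nat.pair_lt_max_add_one_sq a b).trans_le (Nat.pow_le_pow_left (by omega) 2)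

theorem unpair_lt_of_lt_sq {k m : ℕ} (h : k < m ^ 2) : k.unpair.1 < m ∧ k.unpair.2 < m := by
  have h' := Nat.max_sq_add_min_le_pair k.unpair.1 k.unpair.2
  rw [Nat.pair_unpair] at h'
  have : max k.unpair.1 k.unpair.2 < m := lt_of_pow_lt_pow_left₀ 2 (Nat.zero_le _) (by omega)
  omega

theorem encode_ltForm_lt {a c d : ℕ} (hc : c ≤ a) (hd : d ≤ a) :
    Encodable.encode (ltForm c d).1 < initBound a ∧
      Encodable.encode (ltForm c d).2 < initBound a := by
  have := le_sumTo (fun k => Encodable.encode (ltForm k.unpair.1 k.unpair.2).1 +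
    Encodable.encode (ltForm k.unpair.1 k.unpair.2).2)
    (pair_lt_sq (Nat.lt_succ_of_le hc) (Nat.lt_succ_of_le hd))
  simp only [Nat.unpair_pair] at this
  simp only [initBound]
  change _ ≤ sumTo _ ((a + 1) ^ 2) at this
  omega

/-- The list with code `p`. -/
abbrev vec (p : ℕ) : List ℕ := Denumerable.ofNat (List ℕ) p

/-- A bound for the codes of the linear combinations, with coefficients below `m`, of two lists with
codes below `m`. -/
def nextBound (m : ℕ) : ℕ :=
  m + 1 + sumTo (fun k => Encodable.encode (comb k.unpair.1.unpair.1 (vec k.unpair.1.unpair.2)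
    k.unpair.2.unpair.1 (vec k.unpair.2.unpair.2))) ((m ^ 2) ^ 2)

theorem primrec_nextBound : Primrec nextBound := by
  have h : Primrec (Prod.snd : ℕ × ℕ → ℕ) := snd
  exact (Primrec.id.natAdd (const 1)).natAdd (Primrec.sumTo
    (Primrec.encode.comp (h.unpairFst.unpairFst.comb
      ((Primrec.ofNat _).comp h.unpairFst.unpairSnd) h.unpairSnd.unpairFst
      ((Primrec.ofNat _).comp h.unpairSnd.unpairSnd))).to₂ Primrec.id.natSq.natSq)

theorem encode_comb_lt_nextBound {m a p b q : ℕ} (ha : a < m) (hp : p < m) (hb : b < m)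
    (hq : q < m) : Encodable.encode (comb a (vec p) b (vec q)) < nextBound m := by
  have := le_sumTo (fun k => Encodable.encode (comb k.unpair.1.unpair.1 (vec k.unpair.1.unpair.2)
    k.unpair.2.unpair.1 (vec k.unpair.2.unpair.2))) (pair_lt_sq (pair_lt_sq ha hp) (pair_lt_sq hb hq))
  simp only [Nat.unpair_pair] at this
  simp only [nextBound]
  omega

/-- The lists with codes below `level a n` are those that are used at quantifier depth `n`. -/
def level (a n : ℕ) : ℕ := nextBound^[a - n] (initBound a)

theorem level_eq {a n : ℕ} (h : n < a) : level a n = nextBound (level a (n + 1)) := by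
  rw [level, level, show a - n = (a - (n + 1)).succ by omega, Function.iterate_succ_apply']

theorem initBound_le_level (a n : ℕ) : initBound a ≤ level a n :=
  Function.id_le_iterate_of_id_le (fun m => by simp [nextBound]; omega) (a - n) (initBound a)

theorem primrec_level {f g : α → ℕ} (hf : Primrec f) (hg : Primrec g) :
    Primrec fun x => level (f x) (g x) :=
  nat_iterate (hf.natSub hg) (primrec_initBound.comp hf) (primrec_nextBound.comp snd).to₂

/-- Number of variables of the translation of a formula at quantifier depth `n`. -/
def numVars (a n : ℕ) : ℕ := Nat.rec 1 (fun k s => s + level a (k + 1) ^ 2) n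

theorem numVars_succ (a n : ℕ) : numVars a (n + 1) = numVars a n + level a (n + 1) ^ 2 := rfl

theorem numVars_pos (a n : ℕ) : 0 < numVars a n := by
  induction n with
  | zero => exact Nat.one_pos
  | succ n ih => rw [numVars_succ]; omega

theorem primrec_numVars {f g : α → ℕ} (hf : Primrec f) (hg : Primrec g) :
    Primrec fun x => numVars (f x) (g x) :=
  nat_rec' hg (const 1) ((snd.comp snd).natAdd
    (primrec_level (hf.comp fst) (succ.comp (fst.comp snd))).natSq).to₂

/-- The variable for the cozero set `{p < r}` at quantifier depth `n`. -/
def varIdx (a n p r : ℕ) : ℕ :=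
  -- At depth `0` all forms have value `0`, so each `{p < r}` is empty and variable `0`, reserved
  -- for the empty set, represents it.
  Nat.casesOn n 0 fun m => numVars a m + Nat.pair p r

theorem primrec_varIdx {f g p r : α → ℕ} (hf : Primrec f) (hg : Primrec g) (hp : Primrec p)
    (hr : Primrec r) : Primrec fun x => varIdx (f x) (g x) (p x) (r x) :=
  nat_casesOn hg (const 0) ((primrec_numVars (hf.comp fst) snd).natAdd
    ((hp.comp fst).natPair (hr.comp fst))).to₂

theorem varIdx_lt {a n p r : ℕ} (hp : p < level a n) (hr : r < level a n) :
    varIdx a n p r < numVars a n := by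
  cases n with
  | zero => exact Nat.one_pos
  | succ n => exact Nat.add_lt_add_left (pair_lt_sq hp hr) _

theorem numVars_mono_succ (a n : ℕ) : numVars a n ≤ numVars a (n + 1) := Nat.le_add_right _ _

/-! #### Formulas -/

def leCode (i j : ℕ) : ℕ := Nat.pair 2 (Nat.pair 0 (Encodable.encode [2 * i, 2 * j]))

def impCode (x y : ℕ) : ℕ := Nat.pair 3 (Nat.pair x y)

def allCode (x : ℕ) : ℕ := Nat.pair 4 x

/-- Code of `∀ y z, y ≤ x_A → y ≤ x_D → x_B ≤ z → x_E ≤ z → y ≤ z` at quantifier depth `m`, which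
says that `x_A ∩ x_D ⊆ x_B ∪ x_E`. -/
def quadCode (m : ℕ) (q : ℕ × ℕ × ℕ × ℕ) : ℕ :=
  allCode (allCode (impCode (leCode m q.1) (impCode (leCode m q.2.1)
    (impCode (leCode q.2.2.1 (m + 1)) (impCode (leCode q.2.2.2 (m + 1)) (leCode m (m + 1)))))))

theorem Primrec.mkLe {f g : α → ℕ} (hf : Primrec f) (hg : Primrec g) :
    Primrec fun x => leCode (f x) (g x) :=
  (const 2).natPair ((const 0).natPair (Primrec.encode.comp
    ((nat_double.comp hf).listCons ((nat_double.comp hg).listCons (const [])))))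

theorem Primrec.mkImp {f g : α → ℕ} (hf : Primrec f) (hg : Primrec g) :
    Primrec fun x => impCode (f x) (g x) := (const 3).natPair (hf.natPair hg)

theorem Primrec.mkAll {f : α → ℕ} (hf : Primrec f) : Primrec fun x => allCode (f x) :=
  (const 4).natPair hf

theorem Primrec.mkQuad {f : α → ℕ} {q : α → ℕ × ℕ × ℕ × ℕ} (hf : Primrec f) (hq : Primrec q) :
    Primrec fun x => quadCode (f x) (q x) :=
  have hf' := hf.natAdd (const 1)
  Primrec.mkAll (Primrec.mkAll ((hf.mkLe (fst.comp hq)).mkImp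
    ((hf.mkLe (fst.comp (snd.comp hq))).mkImp
      (((fst.comp (snd.comp (snd.comp hq))).mkLe hf').mkImp
        (((snd.comp (snd.comp (snd.comp hq))).mkLe hf').mkImp (hf.mkLe hf'))))))

/-- The linear forms `p - r` and `p' - r'` have coefficients of opposite sign at `n`. -/
def OppositeCoef (n : ℕ) (p r p' r' : List ℕ) : Prop :=
  (r.getD n 0 < p.getD n 0 ∧ p'.getD n 0 < r'.getD n 0) ∨
    (p.getD n 0 < r.getD n 0 ∧ r'.getD n 0 < p'.getD n 0)

instance (n : ℕ) (p r p' r' : List ℕ) : Decidable (OppositeCoef n p r p' r') :=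
  inferInstanceAs (Decidable (_ ∨ _))

/-- Absolute value of the coefficient of `p - r` at `n`. -/
def absCoef (n : ℕ) (p r : List ℕ) : ℕ :=
  (p.getD n 0 - r.getD n 0) + (r.getD n 0 - p.getD n 0)

theorem Primrec.absCoef {n : α → ℕ} {p r : α → List ℕ} (hn : Primrec n) (hp : Primrec p)
    (hr : Primrec r) : Primrec fun x => absCoef (n x) (p x) (r x) :=
  ((hp.getD hn).natSub (hr.getD hn)).natAdd ((hr.getD hn).natSub (hp.getD hn))

/-- Code of the combination of `p` and `p'` with coefficients the absolute values of the
coefficients of `p' - r'` and `p - r` at `n`. -/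
def elim (n : ℕ) (p r p' r' q q' : ℕ) : ℕ :=
  Encodable.encode (comb (absCoef n (vec p') (vec r')) (vec q) (absCoef n (vec p) (vec r)) (vec q'))

/-- The constraints that come from the linear forms `p - r`, `p' - r'`. -/
def quads (a n p r p' r' : ℕ) : List (ℕ × ℕ × ℕ × ℕ) :=
  -- `{p < r}` and `{r < p}` are disjoint; variable `0` stands for the empty set.
  (varIdx a (n + 1) p r, varIdx a (n + 1) r p, 0, 0) ::
  -- Fourier–Motzkin step: the positive combination of `p - r` and `p' - r'` does not involve
  -- variable `n`. If it is negative, one of the two is negative; if `p' - r' > 0` and `p - r ≥ 0`,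
  -- it is positive.
  ((if OppositeCoef n (vec p) (vec r) (vec p') (vec r') then
    [(varIdx a n (elim n p r p' r' p p') (elim n p r p' r' r r'),
      varIdx a n (elim n p r p' r' p p') (elim n p r p' r' r r'),
      varIdx a (n + 1) p r, varIdx a (n + 1) p' r'),
     (varIdx a (n + 1) r' p', varIdx a (n + 1) r' p', varIdx a (n + 1) p r,
      varIdx a n (elim n p r p' r' r r') (elim n p r p' r' p p'))]
  else []) ++
  -- Here variable `n` cancels in `p - r`, so the old and new sets `{p < r}` must coincide; this is
  -- stated as two inclusions.
  (if (vec p).getD n 0 = (vec r).getD n 0 then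
    [(varIdx a n p r, varIdx a n p r, varIdx a (n + 1) p r, 0),
     (varIdx a (n + 1) p r, varIdx a (n + 1) p r, varIdx a n p r, 0)]
  else []))

theorem primrec_quads {a n p r p' r' : α → ℕ} (ha : Primrec a) (hn : Primrec n) (hp : Primrec p)
    (hr : Primrec r) (hp' : Primrec p') (hr' : Primrec r') :
    Primrec fun x => quads (a x) (n x) (p x) (r x) (p' x) (r' x) := by
  have hs := hn.natAdd (const 1)
  have vp := (Primrec.ofNat (List ℕ)).comp hp
  have vr := (Primrec.ofNat (List ℕ)).comp hr
  have vp' := (Primrec.ofNat (List ℕ)).comp hp'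
  have vr' := (Primrec.ofNat (List ℕ)).comp hr'
  have hα := hn.absCoef vp vr
  have hβ := hn.absCoef vp' vr'
  have e1 := Primrec.encode.comp (hβ.comb vp hα vp')
  have e2 := Primrec.encode.comp (hβ.comb vr hα vr')
  have w1 := primrec_varIdx ha hn e1 e2
  have w2 := primrec_varIdx ha hn e2 e1
  have x1 := primrec_varIdx ha hs hp hr
  have x2 := primrec_varIdx ha hs hr hp
  have y1 := primrec_varIdx ha hs hp' hr'
  have y2 := primrec_varIdx ha hs hr' hp'
  have x0 := primrec_varIdx ha hn hp hr
  have z : Primrec fun _ : α => 0 := const 0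
  exact (x1.pair (x2.pair (z.pair z))).listCons (list_append.comp
    (Primrec.ite
      (((nat_lt.comp (vr.getD hn) (vp.getD hn)).and (nat_lt.comp (vp'.getD hn) (vr'.getD hn))).or
        ((nat_lt.comp (vp.getD hn) (vr.getD hn)).and (nat_lt.comp (vr'.getD hn) (vp'.getD hn))))
      ((w1.pair (w1.pair (x1.pair y1))).listCons
        ((y2.pair (y2.pair (x1.pair w2))).listCons (const []))) (const []))
    (Primrec.ite (Primrec.eq.comp (vp.getD hn) (vr.getD hn))
      ((x0.pair (x0.pair (x1.pair z))).listCons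
        ((x1.pair (x1.pair (x0.pair z))).listCons (const []))) (const [])))

/-- All constraints for the step from depth `n` to depth `n + 1`. -/
def blockQuads (a n : ℕ) : List (ℕ × ℕ × ℕ × ℕ) :=
  (List.range ((level a (n + 1) ^ 2) ^ 2)).flatMap fun k =>
    quads a n k.unpair.1.unpair.1 k.unpair.1.unpair.2 k.unpair.2.unpair.1 k.unpair.2.unpair.2

/-- Code of the translation of a universal formula; `x` is the code of the translation of the
formula after the quantifier. -/
def blockCode (a n x : ℕ) : ℕ :=
  allCode^[level a (n + 1) ^ 2]
    ((blockQuads a n).foldr (fun q y => impCode (quadCode (numVars a (n + 1)) q) y) x)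

theorem primrec_blockCode {a n x : α → ℕ} (ha : Primrec a) (hn : Primrec n) (hx : Primrec x) :
    Primrec fun y => blockCode (a y) (n y) (x y) := by
  have hs := hn.natAdd (const 1)
  have hl := primrec_level ha hs
  have hq : Primrec fun y => blockQuads (a y) (n y) :=
    list_flatMap (list_range.comp hl.natSq.natSq)
      (primrec_quads (ha.comp fst) (hn.comp fst) snd.unpairFst.unpairFst snd.unpairFst.unpairSnd
        snd.unpairSnd.unpairFst snd.unpairSnd.unpairSnd).to₂
  exact nat_iterate hl.natSq
    (list_foldr hq hx (Primrec.mkImp (Primrec.mkQuad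
      ((primrec_numVars ha hs).comp fst) (fst.comp snd)) (snd.comp snd)).to₂)
    (Primrec.mkAll snd).to₂

/-- Code of the translation of `t ≤ s`, where `c`, `d` are the codes of `t`, `s`. -/
def atomCode (a n c d : ℕ) : ℕ :=
  -- `t ≤ s` holds pointwise iff `{s < t}` is contained in the empty set, which is variable `0`.
  leCode (varIdx a n (Encodable.encode (ltForm c d).1) (Encodable.encode (ltForm c d).2)) 0

def falsumCode : ℕ := Nat.pair 0 0

/-- Code of the translation of `t = s`, where `c`, `d` are the codes of `t`, `s`. -/
def eqCode (a n c d : ℕ) : ℕ :=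
  impCode (impCode (atomCode a n c d) (impCode (atomCode a n d c) falsumCode)) falsumCode

theorem primrec_atomCode {a n c d : α → ℕ} (ha : Primrec a) (hn : Primrec n) (hc : Primrec c)
    (hd : Primrec d) : Primrec fun x => atomCode (a x) (n x) (c x) (d x) :=
  have h := primrec_ltForm hc hd
  (primrec_varIdx ha hn (Primrec.encode.comp (fst.comp h))
    (Primrec.encode.comp (snd.comp h))).mkLe (const 0)

theorem primrec_eqCode {a n c d : α → ℕ} (ha : Primrec a) (hn : Primrec n) (hc : Primrec c)
    (hd : Primrec d) : Primrec fun x => eqCode (a x) (n x) (c x) (d x) :=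
  ((primrec_atomCode ha hn hc hd).mkImp
    ((primrec_atomCode ha hn hd hc).mkImp (const _))).mkImp (const _)

/-- Code of the translation of the formula with code `c` at quantifier depth `n`. -/
def translateCode (a c n : ℕ) : ℕ :=
  if c.unpair.1 = 0 then falsumCode
  else if c.unpair.1 = 1 then eqCode a n c.unpair.2.unpair.1 c.unpair.2.unpair.2
  else if c.unpair.1 = 2 then
    atomCode a n (firstArg c.unpair.2.unpair.2) (firstArg (restArg c.unpair.2.unpair.2))
  else if c.unpair.1 = 3 then
    impCode (translateCode a c.unpair.2.unpair.1 n) (translateCode a c.unpair.2.unpair.2 n)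
  else blockCode a n (translateCode a c.unpair.2 (n + 1))
termination_by c
decreasing_by
  all_goals
    have h := Nat.add_le_pair c.unpair.1 c.unpair.2
    rw [Nat.pair_unpair] at h
    have h1 := Nat.unpair_left_le c.unpair.2
    have h2 := Nat.unpair_right_le c.unpair.2
    omega

/-- The depth changes during the recursion, so the recursion runs over pairs of code and depth and
is measured by the code alone. -/
theorem primrec_translateCode : Primrec₂ fun a (b : ℕ × ℕ) => translateCode a b.1 b.2 := by
  let l : ℕ → ℕ × ℕ → List (ℕ × ℕ) := fun _ b =>
    if b.1.unpair.1 ≤ 2 then []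
    else if b.1.unpair.1 = 3 then
      [(b.1.unpair.2.unpair.1, b.2), (b.1.unpair.2.unpair.2, b.2)]
    else [(b.1.unpair.2, b.2 + 1)]
  let g : ℕ → (ℕ × ℕ) × List ℕ → Option ℕ := fun a x => some (
    if x.1.1.unpair.1 = 0 then falsumCode
    else if x.1.1.unpair.1 = 1 then eqCode a x.1.2 x.1.1.unpair.2.unpair.1 x.1.1.unpair.2.unpair.2
    else if x.1.1.unpair.1 = 2 then
      atomCode a x.1.2 (firstArg x.1.1.unpair.2.unpair.2)
        (firstArg (restArg x.1.1.unpair.2.unpair.2))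
    else if x.1.1.unpair.1 = 3 then impCode (x.2.getD 0 0) (x.2.getD 1 0)
    else blockCode a x.1.2 (x.2.getD 0 0))
  have hl : Primrec₂ l := by
    have hc : Primrec fun x : ℕ × (ℕ × ℕ) => x.2.1 := fst.comp snd
    have hn : Primrec fun x : ℕ × (ℕ × ℕ) => x.2.2 := snd.comp snd
    exact Primrec.ite (nat_le.comp hc.unpairFst (const 2)) (const [])
      (Primrec.ite (Primrec.eq.comp hc.unpairFst (const 3))
        ((hc.unpairSnd.unpairFst.pair hn).listCons
          ((hc.unpairSnd.unpairSnd.pair hn).listCons (const [])))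
        ((hc.unpairSnd.pair (hn.natAdd (const 1))).listCons (const [])))
  have hg : Primrec₂ g := by
    have ha : Primrec fun x : ℕ × ((ℕ × ℕ) × List ℕ) => x.1 := fst
    have hc : Primrec fun x : ℕ × ((ℕ × ℕ) × List ℕ) => x.2.1.1 := fst.comp (fst.comp snd)
    have hn : Primrec fun x : ℕ × ((ℕ × ℕ) × List ℕ) => x.2.1.2 := snd.comp (fst.comp snd)
    have hx : Primrec fun x : ℕ × ((ℕ × ℕ) × List ℕ) => x.2.2 := snd.comp snd
    exact option_some.comp (Primrec.ite (Primrec.eq.comp hc.unpairFst (const 0)) (const _)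
      (Primrec.ite (Primrec.eq.comp hc.unpairFst (const 1))
        (primrec_eqCode ha hn hc.unpairSnd.unpairFst hc.unpairSnd.unpairSnd)
        (Primrec.ite (Primrec.eq.comp hc.unpairFst (const 2))
          (primrec_atomCode ha hn (primrec_firstArg hc.unpairSnd.unpairSnd)
            (primrec_firstArg (primrec_restArg hc.unpairSnd.unpairSnd)))
          (Primrec.ite (Primrec.eq.comp hc.unpairFst (const 3))
            ((hx.getD (const 0)).mkImp (hx.getD (const 1)))
            (primrec_blockCode ha hn (hx.getD (const 0)))))))
  refine nat_omega_rec (fun a (b : ℕ × ℕ) => translateCode a b.1 b.2) (m := fun _ b => b.1)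
    (fst.comp snd).to₂ hl hg ?_ ?_
  · rintro a ⟨c, n⟩ ⟨c', n'⟩ h
    have h0 := Nat.add_le_pair c.unpair.1 c.unpair.2
    rw [Nat.pair_unpair] at h0
    have h1 := Nat.unpair_left_le c.unpair.2
    have h2 := Nat.unpair_right_le c.unpair.2
    simp only [l] at h
    split_ifs at h
    · simp at h
    · simp only [List.mem_cons, Prod.mk.injEq, List.not_mem_nil, or_false] at h
      dsimp only
      omega
    · simp only [List.mem_cons, Prod.mk.injEq, List.not_mem_nil, or_false] at h
      dsimp only
      omega
  · rintro a ⟨c, n⟩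
    dsimp only
    rw [translateCode]
    by_cases h0 : c.unpair.1 = 0
    · simp [g, h0]
    by_cases h1 : c.unpair.1 = 1
    · simp [g, h1]
    by_cases h2 : c.unpair.1 = 2
    · simp [g, h2]
    have h3 : ¬ c.unpair.1 ≤ 2 := by omega
    by_cases h4 : c.unpair.1 = 3
    · simp [g, l, h4]
    · simp [g, l, h0, h1, h2, h3, h4]

/-- Code of the translation of the sentence with code `c`. -/
def translateSentence (c : ℕ) : ℕ :=
  -- The language has no constant for the empty set; the premise forces `x_0` to be the least
  -- element. The code itself serves as the bound `a`.
  allCode (impCode (allCode (leCode 0 1)) (translateCode c c 0))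

theorem primrec_translateSentence : Primrec translateSentence :=
  Primrec.mkAll ((const _).mkImp (primrec_translateCode.comp Primrec.id
    (Primrec.id.pair (const 0))))

end Coding

/-! ### Formulas in the language of orders -/

section OrderFormulas

open FirstOrder Language

variable {X : Type u} {M : Type v}

/-- The underlying set of a cozero set. -/
def CozeroSets.toSet [Zero M] {C : Set (X → M)} (U : CozeroSets C) : Set X := Subtype.val U

theorem CozeroSets.le_iff [Zero M] {C : Set (X → M)} {U V : CozeroSets C} :
    U ≤ V ↔ U.toSet ⊆ V.toSet := Iff.rfl

theorem CozeroSets.ext [Zero M] {C : Set (X → M)} {U V : CozeroSets C}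
    (h : U.toSet = V.toSet) : U = V := Subtype.ext h

def leFormula {m : ℕ} (i j : Fin m) : Language.order.BoundedFormula Empty m :=
  .rel (Language.orderRel.le : Language.order.Relations 2)
    (fun k : Fin 2 => if k = 0 then .var (.inr i) else .var (.inr j))

theorem formulaCode_leFormula {m : ℕ} (i j : Fin m) :
    formulaCode (leFormula i j) = leCode i j := by
  simp only [leFormula, formulaCode, leCode]
  have : @Encodable.encode (Language.order.Relations 2) _ Language.orderRel.le = 0 := rfl
  simp [this, List.ofFn_succ, termCode]

theorem formulaCode_imp {m : ℕ} (φ ψ : Language.order.BoundedFormula Empty m) :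
    formulaCode (φ.imp ψ) = impCode (formulaCode φ) (formulaCode ψ) := by
  simp only [formulaCode, impCode]

theorem formulaCode_all {m : ℕ} (φ : Language.order.BoundedFormula Empty (m + 1)) :
    formulaCode φ.all = allCode (formulaCode φ) := by
  simp only [formulaCode, allCode]

theorem realize_leFormula [Zero M] {C : Set (X → M)} {m : ℕ} (i j : Fin m)
    (v : Empty → CozeroSets C) (x : Fin m → CozeroSets C) :
    (leFormula i j).Realize v x ↔ x i ≤ x j := Iff.rfl

theorem snoc_restrict {S : Type*} (s : ℕ → S) (m : ℕ) (y : S) :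
    (Fin.snoc (fun i : Fin m => s i) y : Fin (m + 1) → S) =
      fun i : Fin (m + 1) => Function.update s m y i := by
  funext i
  refine Fin.lastCases ?_ (fun i => ?_) i
  · simp
  · simp [Function.update_of_ne i.2.ne]

/-- Assignments are sequences indexed by `ℕ`, so a block of quantifiers ranges over the sequences
that agree below `m`. This avoids iterated `Fin.snoc`. -/
theorem exists_alls {S : Type*} [Language.order.Structure S] {m : ℕ} (k : ℕ)
    (ψ : Language.order.BoundedFormula Empty (m + k)) :
    ∃ χ : Language.order.BoundedFormula Empty m,
      formulaCode χ = allCode^[k] (formulaCode ψ) ∧ ∀ (v : Empty → S) (s : ℕ → S),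
        χ.Realize v (fun i => s i) ↔
          ∀ s' : ℕ → S, (∀ i < m, s' i = s i) → ψ.Realize v (fun i => s' i) := by
  induction k with
  | zero =>
    refine ⟨ψ, rfl, fun v s => ⟨fun h s' hs' => ?_, fun h => h s fun _ _ => rfl⟩⟩
    have : (fun i : Fin m => s' i) = fun i : Fin m => s i := funext fun i => hs' i i.2
    exact this ▸ h
  | succ k ih =>
    obtain ⟨χ, hχ, h⟩ := ih ψ.all
    refine ⟨χ, by rw [hχ, Function.iterate_succ_apply]; rfl, fun v s => (h v s).trans ?_⟩
    constructor
    · intro H s' hs'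
      have := BoundedFormula.realize_all.1 (H s' hs') (s' (m + k))
      rw [snoc_restrict, Function.update_eq_self] at this
      exact this
    · intro H s' hs'
      refine BoundedFormula.realize_all.2 fun y => ?_
      rw [snoc_restrict]
      refine H _ fun i hi => ?_
      rw [Function.update_of_ne (by omega), hs' i hi]

end OrderFormulas

/-! ### Semantics of the translation -/

section Forms

variable {X : Type u} {M : Type v} [AddCommGroup M] [Module ℚ M] {C : Submodule ℚ (X → M)}

/-- The value of the linear form with coefficients `p` in the first `n` variables. -/
def ev (F : ℕ → C) (n : ℕ) (p : List ℕ) : C := ∑ i ∈ Finset.range n, p.getD i 0 • F i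

theorem ev_comb (F : ℕ → C) (n a b : ℕ) (p q : List ℕ) :
    ev F n (comb a p b q) = a • ev F n p + b • ev F n q := by
  simp only [ev, comb_getD, add_smul, mul_smul, Finset.sum_add_distrib, Finset.smul_sum]

theorem ev_update (F : ℕ → C) (n : ℕ) (p : List ℕ) (f : C) :
    ev (Function.update F n f) (n + 1) p = ev F n p + p.getD n 0 • f := by
  rw [ev, Finset.sum_range_succ, Function.update_self, ev]
  congr 1
  exact Finset.sum_congr rfl fun i hi => by
    rw [Function.update_of_ne (Finset.mem_range.1 hi).ne]

theorem ev_elim (F : ℕ → C) (n k p r p' r' q q' : ℕ) :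
    ev F k (vec (elim n p r p' r' q q')) = absCoef n (vec p') (vec r') • ev F k (vec q) +
      absCoef n (vec p) (vec r) • ev F k (vec q') := by
  rw [elim, vec, Denumerable.ofNat_encode, ev_comb]

end Forms

section Order

variable {M : Type v} [AddCommGroup M] [LinearOrder M] [IsOrderedAddMonoid M]

theorem nsmul_lt_nsmul_iff_right' {k : ℕ} (hk : k ≠ 0) {f t : M} : k • f < k • t ↔ f < t :=
  (nsmul_right_strictMono hk).lt_iff_lt

theorem add_nsmul_lt_iff {p r f t : M} {k l : ℕ} (hkl : l < k) (ht : (k - l) • t = r - p) :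
    f < t ↔ p + k • f < r + l • f := by
  obtain ⟨d, rfl⟩ := Nat.exists_eq_add_of_lt hkl
  rw [show l + d + 1 - l = d + 1 by omega] at ht
  rw [← nsmul_lt_nsmul_iff_right' (Nat.succ_ne_zero d), Nat.succ_eq_add_one, ht, lt_sub_iff_add_lt,
    show l + d + 1 = (d + 1) + l by omega, add_nsmul f (d + 1) l, ← add_assoc, add_lt_add_iff_right,
    add_comm]

theorem nsmul_add_lt_iff {p r f t : M} {k l : ℕ} (hkl : l < k) (ht : (k - l) • t = r - p) :
    t < f ↔ r + l • f < p + k • f := by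
  obtain ⟨d, rfl⟩ := Nat.exists_eq_add_of_lt hkl
  rw [show l + d + 1 - l = d + 1 by omega] at ht
  rw [← nsmul_lt_nsmul_iff_right' (Nat.succ_ne_zero d), Nat.succ_eq_add_one, ht, sub_lt_iff_lt_add,
    show l + d + 1 = (d + 1) + l by omega, add_nsmul f (d + 1) l, ← add_assoc, add_lt_add_iff_right,
    add_comm]

/-- Multiply by `k * l` and move the subtracted terms across: comparisons of quotients become
comparisons of forms without denominators or signs. -/
theorem lt_iff_of_nsmul_eq {k l : ℕ} (hk : 0 < k) (hl : 0 < l) {t u p r p' r' : M}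
    (ht : k • t = r - p) (hu : l • u = r' - p') :
    u < t ↔ l • p + k • r' < l • r + k • p' := by
  rw [← nsmul_lt_nsmul_iff_right' (Nat.mul_pos hk hl).ne', mul_nsmul' u, hu, mul_nsmul t, ht,
    nsmul_sub, nsmul_sub, sub_lt_sub_iff, add_comm (k • r')]

end Order

section Semantics

open FirstOrder Language

variable {X : Type u} {M : Type v} [TopologicalSpace X] [AddCommGroup M] [LinearOrder M]
  [Module ℚ M] [TopologicalSpace M] {C : Submodule ℚ (X → M)}

theorem IsConstructibleLGroup.isCozero_union [IsOrderedAddMonoid M] (hC : IsConstructibleLGroup C)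
    {U V : Set X}
    (hU : IsCozeroSetOf (C : Set (X → M)) U) (hV : IsCozeroSetOf (C : Set (X → M)) V) :
    IsCozeroSetOf (C : Set (X → M)) (U ∪ V) := by
  obtain ⟨f, hf, hfU⟩ := hU
  obtain ⟨g, hg, hgV⟩ := hV
  refine ⟨(fun x => |f x|) ⊔ fun x => |g x|, hC.sup_mem _ (hC.abs_mem hf) _ (hC.abs_mem hg), ?_⟩
  rw [Set.compl_union, hfU, hgV]
  ext x
  simp only [Set.mem_inter_iff, Set.mem_ofPred_eq, Pi.sup_apply]
  refine ⟨fun h => by simp [h.1, h.2], fun h => ⟨?_, ?_⟩⟩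
  · exact abs_nonpos_iff.1 (h ▸ le_sup_left)
  · exact abs_nonpos_iff.1 (h ▸ le_sup_right)

theorem IsConstructibleLGroup.isCozero_inter [IsOrderedAddMonoid M] (hC : IsConstructibleLGroup C)
    {U V : Set X}
    (hU : IsCozeroSetOf (C : Set (X → M)) U) (hV : IsCozeroSetOf (C : Set (X → M)) V) :
    IsCozeroSetOf (C : Set (X → M)) (U ∩ V) := by
  obtain ⟨f, hf, hfU⟩ := hU
  obtain ⟨g, hg, hgV⟩ := hV
  refine ⟨(fun x => |f x|) ⊓ fun x => |g x|, hC.inf_mem _ (hC.abs_mem hf) _ (hC.abs_mem hg), ?_⟩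
  rw [Set.compl_inter, hfU, hgV]
  ext x
  simp only [Set.mem_union, Set.mem_ofPred_eq, Pi.inf_apply]
  constructor
  · rintro (h | h) <;> simp [h]
  · intro h
    rcases le_total |f x| |g x| with h' | h'
    · rw [inf_eq_left.2 h'] at h
      exact .inl (abs_eq_zero.1 h)
    · rw [inf_eq_right.2 h'] at h
      exact .inr (abs_eq_zero.1 h)

theorem IsConstructibleLGroup.isCozero_lt [IsOrderedAddMonoid M] (hC : IsConstructibleLGroup C)
    (f g : C) : IsCozeroSetOf (C : Set (X → M)) {x | f.1 x < g.1 x} := by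
  refine ⟨(g.1 - f.1) ⊔ 0, hC.sup_mem _ (C.sub_mem g.2 f.2) _ C.zero_mem, ?_⟩
  ext x
  simp

/-- The cozero set `{f < g}`. -/
def ltSet [IsOrderedAddMonoid M] (hC : IsConstructibleLGroup C) (f g : C) :
    CozeroSets (C : Set (X → M)) := Subtype.mk {x | f.1 x < g.1 x} (hC.isCozero_lt f g)

theorem mem_ltSet [IsOrderedAddMonoid M] {hC : IsConstructibleLGroup C} {f g : C} {x : X} :
    x ∈ (ltSet hC f g).toSet ↔ f.1 x < g.1 x := Iff.rfl

def unionSet [IsOrderedAddMonoid M] (hC : IsConstructibleLGroup C)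
    (U V : CozeroSets (C : Set (X → M))) : CozeroSets (C : Set (X → M)) :=
  Subtype.mk (U.toSet ∪ V.toSet) (hC.isCozero_union U.2 V.2)

def interSet [IsOrderedAddMonoid M] (hC : IsConstructibleLGroup C)
    (U V : CozeroSets (C : Set (X → M))) : CozeroSets (C : Set (X → M)) :=
  Subtype.mk (U.toSet ∩ V.toSet) (hC.isCozero_inter U.2 V.2)

/-- `x_A ∩ x_D ⊆ x_B ∪ x_E`. -/
def QuadHolds (s : ℕ → CozeroSets (C : Set (X → M))) (q : ℕ × ℕ × ℕ × ℕ) : Prop :=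
  ∀ x, x ∈ (s q.1).toSet → x ∈ (s q.2.1).toSet →
    x ∈ (s q.2.2.1).toSet ∨ x ∈ (s q.2.2.2).toSet

/-- Union and intersection are expressed through the order alone. One direction instantiates `y` and
`z` by the actual intersection and union, which are again cozero sets. -/
theorem exists_quadFormula [IsOrderedAddMonoid M] (hC : IsConstructibleLGroup C) {m : ℕ}
    {q : ℕ × ℕ × ℕ × ℕ} (h1 : q.1 < m) (h2 : q.2.1 < m) (h3 : q.2.2.1 < m) (h4 : q.2.2.2 < m) :
    ∃ χ : Language.order.BoundedFormula Empty m, formulaCode χ = quadCode m q ∧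
      ∀ (v : Empty → CozeroSets (C : Set (X → M))) (s : ℕ → CozeroSets (C : Set (X → M))),
        χ.Realize v (fun i => s i) ↔ QuadHolds s q := by
  let y : Fin (m + 2) := ⟨m, by omega⟩
  let z : Fin (m + 2) := ⟨m + 1, by omega⟩
  let A : Fin (m + 2) := ⟨q.1, by omega⟩
  let D : Fin (m + 2) := ⟨q.2.1, by omega⟩
  let B : Fin (m + 2) := ⟨q.2.2.1, by omega⟩
  let E : Fin (m + 2) := ⟨q.2.2.2, by omega⟩
  obtain ⟨χ, hχ, h⟩ := exists_alls (S := CozeroSets (C : Set (X → M))) 2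
    ((leFormula y A).imp ((leFormula y D).imp ((leFormula B z).imp ((leFormula E z).imp
      (leFormula y z)))))
  refine ⟨χ, ?_, fun v s => (h v s).trans ?_⟩
  · have h2 : ∀ x, allCode^[2] x = allCode (allCode x) := fun _ => rfl
    simp only [hχ, h2, formulaCode_imp, formulaCode_leFormula, quadCode, y, z, A, D, B, E]
  · simp only [BoundedFormula.realize_imp, realize_leFormula]
    constructor
    · intro H x hA hD
      let I : CozeroSets (C : Set (X → M)) := interSet hC (s q.1) (s q.2.1)
      let U : CozeroSets (C : Set (X → M)) := unionSet hC (s q.2.2.1) (s q.2.2.2)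
      let s' : ℕ → CozeroSets (C : Set (X → M)) :=
        Function.update (Function.update s m I) (m + 1) U
      have hs' : ∀ i < m, s' i = s i := fun i hi => by
        simp only [s']
        rw [Function.update_of_ne (by omega), Function.update_of_ne (by omega)]
      have hy : s' y = I := by simp [s', y]
      have hz : s' z = U := by simp [s', z]
      have := H s' hs'
      rw [hy, hz, hs' _ h1, hs' _ h2, hs' _ h3, hs' _ h4] at this
      exact this Set.inter_subset_left Set.inter_subset_right Set.subset_union_left
        Set.subset_union_right ⟨hA, hD⟩
    · intro H s' hs' hA hD hB hE x hx
      rw [hs' _ h1] at hA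
      rw [hs' _ h2] at hD
      rw [hs' _ h3] at hB
      rw [hs' _ h4] at hE
      rcases H x (hA hx) (hD hx) with h' | h'
      · exact hB h'
      · exact hE h'

theorem exists_quadsFormula [IsOrderedAddMonoid M] (hC : IsConstructibleLGroup C) {m : ℕ}
    (qs : List (ℕ × ℕ × ℕ × ℕ))
    (hqs : ∀ q ∈ qs, q.1 < m ∧ q.2.1 < m ∧ q.2.2.1 < m ∧ q.2.2.2 < m)
    (ψ : Language.order.BoundedFormula Empty m) :
    ∃ χ : Language.order.BoundedFormula Empty m,
      formulaCode χ = qs.foldr (fun q y => impCode (quadCode m q) y) (formulaCode ψ) ∧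
      ∀ (v : Empty → CozeroSets (C : Set (X → M))) (s : ℕ → CozeroSets (C : Set (X → M))),
        χ.Realize v (fun i => s i) ↔ ((∀ q ∈ qs, QuadHolds s q) → ψ.Realize v (fun i => s i)) := by
  induction qs with
  | nil => exact ⟨ψ, rfl, fun v s => by simp⟩
  | cons q qs ih =>
    obtain ⟨χ, hχ, h⟩ := ih fun q' hq' => hqs q' (List.mem_cons_of_mem _ hq')
    obtain ⟨h1, h2, h3, h4⟩ := hqs q List.mem_cons_self
    obtain ⟨χ', hχ', h'⟩ := exists_quadFormula hC h1 h2 h3 h4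
    refine ⟨χ'.imp χ, ?_, fun v s => ?_⟩
    · simp only [formulaCode, hχ, hχ', List.foldr_cons, impCode]
    · rw [BoundedFormula.realize_imp, h, h']
      simp

theorem getD_le_encode (l : List ℕ) (i : ℕ) : l.getD i 0 ≤ Encodable.encode l := by
  induction l generalizing i with
  | nil => simp
  | cons a l ih =>
    rw [Encodable.encode_list_cons]
    have h1 := Nat.left_le_pair a (Encodable.encode l)
    have h2 := Nat.right_le_pair a (Encodable.encode l)
    cases i with
    | zero => simp only [List.getD_cons_zero, Encodable.encode_nat]; omega
    | succ i =>
      have := ih i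
      simp only [List.getD_cons_succ, Encodable.encode_nat]
      omega

theorem absCoef_lt {m p r : ℕ} (hp : p < m) (hr : r < m) (n : ℕ) :
    absCoef n (vec p) (vec r) < m := by
  have h1 := getD_le_encode (vec p) n
  have h2 := getD_le_encode (vec r) n
  rw [Denumerable.encode_ofNat] at h1 h2
  simp only [absCoef]
  omega

/-- The multipliers are at most entries of the lists, hence at most their codes, so the combination
is among those counted by `nextBound`. -/
theorem elim_lt {a n p r p' r' q q' : ℕ} (hn : n < a) (hp : p < level a (n + 1))
    (hr : r < level a (n + 1)) (hp' : p' < level a (n + 1)) (hr' : r' < level a (n + 1))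
    (hq : q < level a (n + 1)) (hq' : q' < level a (n + 1)) :
    elim n p r p' r' q q' < level a n := by
  rw [level_eq hn]
  exact encode_comb_lt_nextBound (absCoef_lt hp' hr' n) hq (absCoef_lt hp hr n) hq'

theorem lt_level_of_lt_succ {a n p : ℕ} (hn : n < a) (hp : p < level a (n + 1)) :
    p < level a n := by
  rw [level_eq hn, nextBound]
  omega

theorem OppositeCoef.absCoef_pos {n : ℕ} {p r p' r' : List ℕ} (h : OppositeCoef n p r p' r') :
    0 < absCoef n p r ∧ 0 < absCoef n p' r' := by
  simp only [OppositeCoef, absCoef] at *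
  omega

/-- Crosswise multiplication by absolute values makes coefficients of opposite sign add up to zero;
the identity is arranged so as to stay in `ℕ`. -/
theorem OppositeCoef.cancel {n : ℕ} {p r p' r' : List ℕ} (h : OppositeCoef n p r p' r') :
    absCoef n p' r' * p.getD n 0 + absCoef n p r * p'.getD n 0 =
      absCoef n p' r' * r.getD n 0 + absCoef n p r * r'.getD n 0 := by
  simp only [OppositeCoef, absCoef] at *
  generalize p.getD n 0 = a at *
  generalize r.getD n 0 = b at *
  generalize p'.getD n 0 = c at *
  generalize r'.getD n 0 = d at *
  rcases h with ⟨h1, h2⟩ | ⟨h1, h2⟩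
  · obtain ⟨k, rfl⟩ := Nat.exists_eq_add_of_lt h1
    obtain ⟨l, rfl⟩ := Nat.exists_eq_add_of_lt h2
    rw [show b + k + 1 - b = k + 1 by omega, show b - (b + k + 1) = 0 by omega,
      show c + l + 1 - c = l + 1 by omega, show c - (c + l + 1) = 0 by omega]
    ring
  · obtain ⟨k, rfl⟩ := Nat.exists_eq_add_of_lt h1
    obtain ⟨l, rfl⟩ := Nat.exists_eq_add_of_lt h2
    rw [show a + k + 1 - a = k + 1 by omega, show a - (a + k + 1) = 0 by omega,
      show d + l + 1 - d = l + 1 by omega, show d - (d + l + 1) = 0 by omega]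
    ring

theorem mem_blockQuads {a n : ℕ} {q : ℕ × ℕ × ℕ × ℕ} :
    q ∈ blockQuads a n ↔ ∃ p < level a (n + 1), ∃ r < level a (n + 1), ∃ p' < level a (n + 1),
      ∃ r' < level a (n + 1), q ∈ quads a n p r p' r' := by
  simp only [blockQuads, List.mem_flatMap, List.mem_range]
  constructor
  · rintro ⟨k, hk, hq⟩
    obtain ⟨h1, h2⟩ := unpair_lt_of_lt_sq hk
    obtain ⟨h1, h1'⟩ := unpair_lt_of_lt_sq h1
    obtain ⟨h2, h2'⟩ := unpair_lt_of_lt_sq h2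
    exact ⟨_, h1, _, h1', _, h2, _, h2', hq⟩
  · rintro ⟨p, hp, r, hr, p', hp', r', hr', hq⟩
    refine ⟨Nat.pair (Nat.pair p r) (Nat.pair p' r'),
      pair_lt_sq (pair_lt_sq hp hr) (pair_lt_sq hp' hr'), ?_⟩
    simpa only [Nat.unpair_pair] using hq

theorem mem_quads {a n p r p' r' : ℕ} {q : ℕ × ℕ × ℕ × ℕ} :
    q ∈ quads a n p r p' r' ↔ q = (varIdx a (n + 1) p r, varIdx a (n + 1) r p, 0, 0) ∨
      (OppositeCoef n (vec p) (vec r) (vec p') (vec r') ∧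
        (q = (varIdx a n (elim n p r p' r' p p') (elim n p r p' r' r r'),
          varIdx a n (elim n p r p' r' p p') (elim n p r p' r' r r'),
          varIdx a (n + 1) p r, varIdx a (n + 1) p' r') ∨
        q = (varIdx a (n + 1) r' p', varIdx a (n + 1) r' p', varIdx a (n + 1) p r,
          varIdx a n (elim n p r p' r' r r') (elim n p r p' r' p p')))) ∨
      ((vec p).getD n 0 = (vec r).getD n 0 ∧
        (q = (varIdx a n p r, varIdx a n p r, varIdx a (n + 1) p r, 0) ∨
        q = (varIdx a (n + 1) p r, varIdx a (n + 1) p r, varIdx a n p r, 0))) := by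
  simp only [quads]
  split_ifs with h1 h2 h2 <;>
    simp only [List.mem_cons, List.mem_append, List.not_mem_nil, h1, h2] <;> tauto

theorem lt_numVars_of_mem_blockQuads {a n : ℕ} (hn : n < a) {q : ℕ × ℕ × ℕ × ℕ}
    (hq : q ∈ blockQuads a n) : q.1 < numVars a (n + 1) ∧ q.2.1 < numVars a (n + 1) ∧
      q.2.2.1 < numVars a (n + 1) ∧ q.2.2.2 < numVars a (n + 1) := by
  obtain ⟨p, hp, r, hr, p', hp', r', hr', hq⟩ := mem_blockQuads.1 hq
  have h0 := numVars_pos a (n + 1)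
  have hle := numVars_mono_succ a n
  have h1 := varIdx_lt hp hr
  have h2 := varIdx_lt hr hp
  have h3 := varIdx_lt hp' hr'
  have h4 := varIdx_lt hr' hp'
  have e1 := elim_lt hn hp hr hp' hr' hp hp'
  have e2 := elim_lt hn hp hr hp' hr' hr hr'
  have h5 := (varIdx_lt e1 e2).trans_le hle
  have h6 := (varIdx_lt e2 e1).trans_le hle
  have h7 := (varIdx_lt (lt_level_of_lt_succ hn hp) (lt_level_of_lt_succ hn hr)).trans_le hle
  rcases mem_quads.1 hq with rfl | ⟨-, rfl | rfl⟩ | ⟨-, rfl | rfl⟩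
  · exact ⟨h1, h2, h0, h0⟩
  · exact ⟨h5, h5, h1, h3⟩
  · exact ⟨h4, h4, h1, h6⟩
  · exact ⟨h7, h7, h1, h0⟩
  · exact ⟨h1, h1, h7, h0⟩

variable [IsOrderedAddMonoid M]

/-- The assignment `s` of cozero sets to the variables at quantifier depth `n` is the one given by
the functions `F 0, …, F (n - 1)`. -/
def Represents (hC : IsConstructibleLGroup C) (a n : ℕ) (F : ℕ → C)
    (s : ℕ → CozeroSets (C : Set (X → M))) : Prop :=
  (s 0).toSet = ∅ ∧ ∀ p < level a n, ∀ r < level a n,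
    s (varIdx a n p r) = ltSet hC (ev F n (vec p)) (ev F n (vec r))

theorem Represents.congr {hC : IsConstructibleLGroup C} {a n : ℕ} {F : ℕ → C}
    {s s' : ℕ → CozeroSets (C : Set (X → M))} (h : Represents hC a n F s)
    (hs : ∀ i < numVars a n, s' i = s i) : Represents hC a n F s' :=
  ⟨by rw [hs 0 (numVars_pos a n)]; exact h.1,
    fun p hp r hr => by rw [hs _ (varIdx_lt hp hr)]; exact h.2 p hp r hr⟩

theorem Represents.exists_succ {hC : IsConstructibleLGroup C} {a n : ℕ} {F : ℕ → C}
    {s : ℕ → CozeroSets (C : Set (X → M))} (h : Represents hC a n F s) (f : C) :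
    ∃ s' : ℕ → CozeroSets (C : Set (X → M)), (∀ i < numVars a n, s' i = s i) ∧
      Represents hC a (n + 1) (Function.update F n f) s' := by
  -- The new block is filled with the true sets for `f`; the pair of forms is read off from the
  -- offset of the index.
  refine ⟨fun i => if i < numVars a n then s i else
    ltSet hC (ev (Function.update F n f) (n + 1) (vec (i - numVars a n).unpair.1))
      (ev (Function.update F n f) (n + 1) (vec (i - numVars a n).unpair.2)),
    fun i hi => if_pos hi, ?_, fun p hp r hr => ?_⟩
  · simp only [if_pos (numVars_pos a n)]
    exact h.1
  · have : varIdx a (n + 1) p r = numVars a n + Nat.pair p r := rfl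
    simp only [this, if_neg (Nat.not_lt.2 (Nat.le_add_right (numVars a n) (Nat.pair p r))),
      Nat.add_sub_cancel_left, Nat.unpair_pair]

/-- The translated constraints hold for every function. -/
theorem Represents.quadHolds {hC : IsConstructibleLGroup C} {a n : ℕ} (hn : n < a) {F : ℕ → C}
    {s : ℕ → CozeroSets (C : Set (X → M))} (h : Represents hC a n F s) {f : C}
    (h' : Represents hC a (n + 1) (Function.update F n f) s) :
    ∀ q ∈ blockQuads a n, QuadHolds s q := by
  intro q hq
  obtain ⟨p, hp, r, hr, p', hp', r', hr', hq⟩ := mem_blockQuads.1 hq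
  have e1 := elim_lt hn hp hr hp' hr' hp hp'
  have e2 := elim_lt hn hp hr hp' hr' hr hr'
  have hsum : ∀ k l (q q' : ℕ) (x : X),
      k • (ev (Function.update F n f) (n + 1) (vec q)).1 x +
        l • (ev (Function.update F n f) (n + 1) (vec q')).1 x =
      (k • (ev F n (vec q)).1 x + l • (ev F n (vec q')).1 x) +
        (k * (vec q).getD n 0 + l * (vec q').getD n 0) • f.1 x := by
    intro k l q q' x
    rw [ev_update, ev_update]
    change k • ((ev F n (vec q)).1 x + (vec q).getD n 0 • f.1 x) +
      l • ((ev F n (vec q')).1 x + (vec q').getD n 0 • f.1 x) = _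
    rw [add_smul, mul_smul, mul_smul, smul_add, smul_add]
    abel
  have hel : ∀ (q q' : ℕ) (x : X), (ev F n (vec (elim n p r p' r' q q'))).1 x =
      absCoef n (vec p') (vec r') • (ev F n (vec q)).1 x +
        absCoef n (vec p) (vec r) • (ev F n (vec q')).1 x := fun q q' x => by
    rw [ev_elim]; rfl
  rcases mem_quads.1 hq with rfl | ⟨ho, rfl | rfl⟩ | ⟨he, rfl | rfl⟩ <;> intro x
  · rw [h'.2 p hp r hr, h'.2 r hr p hp]
    exact fun h1 h2 => absurd h1 (lt_asymm (mem_ltSet.1 h2))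
  · rw [h'.2 p hp r hr, h'.2 p' hp' r' hr', h.2 _ e1 _ e2]
    intro h1 _
    rw [mem_ltSet] at h1
    simp only [mem_ltSet]
    rw [hel, hel] at h1
    -- The same multiple of `f` is added on both sides; by `ho.cancel` it is the contribution of `f`
    -- to either combination.
    rw [← add_lt_add_iff_right ((absCoef n (vec p') (vec r') * (vec p).getD n 0 +
      absCoef n (vec p) (vec r) * (vec p').getD n 0) • f.1 x), ← hsum, ho.cancel, ← hsum] at h1
    by_contra hc
    rw [not_or, not_lt, not_lt] at hc
    exact absurd h1 (not_lt.2 (add_le_add (nsmul_le_nsmul_right hc.1 _)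
      (nsmul_le_nsmul_right hc.2 _)))
  · rw [h'.2 p hp r hr, h'.2 r' hr' p' hp', h.2 _ e2 _ e1]
    intro h1 _
    rw [mem_ltSet] at h1
    simp only [mem_ltSet]
    by_contra hc
    rw [not_or, not_lt] at hc
    refine hc.2 ?_
    rw [hel, hel, ← add_lt_add_iff_right ((absCoef n (vec p') (vec r') * (vec p).getD n 0 +
      absCoef n (vec p) (vec r) * (vec p').getD n 0) • f.1 x), ← hsum, ho.cancel, ← hsum]
    exact (add_lt_add_of_le_of_lt (nsmul_le_nsmul_right hc.1 _)
      (nsmul_lt_nsmul_right ho.absCoef_pos.1.ne' h1))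
  all_goals
    rw [h'.2 p hp r hr, h.2 p (lt_level_of_lt_succ hn hp) r (lt_level_of_lt_succ hn hr)]
    intro h1 _
    left
    rw [mem_ltSet] at *
    rw [ev_update, ev_update, ← he] at *
    first
    | exact add_lt_add_left h1 _
    | exact lt_of_add_lt_add_right h1

variable [OrderTopology M]

/-- If the translated constraints hold, then the assignment is given by a function. -/
theorem Represents.exists_of_quadHolds {hC : IsConstructibleLGroup C} {a n : ℕ} (hn : n < a)
    {F : ℕ → C} {s : ℕ → CozeroSets (C : Set (X → M))} (h : Represents hC a n F s)
    (hq : ∀ q ∈ blockQuads a n, QuadHolds s q) :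
    ∃ f : C, Represents hC a (n + 1) (Function.update F n f) s := by
  let m := level a (n + 1)
  let coef : ℕ → ℕ := fun p => (vec p).getD n 0
  -- A pair `(p, r)` in which variable `n` has the larger coefficient in `p` gives one threshold
  -- `t`: `p < r` means `f < t`, and `r < p` means `t < f`. Swapped pairs add nothing, and pairs
  -- with equal coefficients do not involve `f`.
  let J := {k : Fin m × Fin m // coef k.2 < coef k.1}
  have hquad : ∀ p < m, ∀ r < m, ∀ p' < m, ∀ r' < m, ∀ q ∈ quads a n p r p' r', QuadHolds s q :=
    fun p hp r hr p' hp' r' hr' q hq' =>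
      hq q (mem_blockQuads.2 ⟨p, hp, r, hr, p', hp', r', hr', hq'⟩)
  have hempty : ∀ x, x ∉ (s 0).toSet := fun x hx => by rw [h.1] at hx; exact hx
  have hdisj : ∀ p < m, ∀ r < m, ∀ x, x ∈ (s (varIdx a (n + 1) p r)).toSet →
      x ∉ (s (varIdx a (n + 1) r p)).toSet := by
    intro p hp r hr x h1 h2
    exact (hquad p hp r hr p hp r hr _ (mem_quads.2 (.inl rfl)) x h1 h2).elim (hempty x) (hempty x)
  let t : J → X → M := fun k => ((coef k.1.1 - coef k.1.2 : ℕ) : ℚ)⁻¹ •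
    ((ev F n (vec k.1.2)).1 - (ev F n (vec k.1.1)).1)
  have htC : ∀ k, t k ∈ C := fun k => C.smul_mem _ (C.sub_mem (ev F n _).2 (ev F n _).2)
  have ht : ∀ k x, (coef k.1.1 - coef k.1.2) • t k x =
      (ev F n (vec k.1.2)).1 x - (ev F n (vec k.1.1)).1 x := by
    intro k x
    have hk : ((coef k.1.1 - coef k.1.2 : ℕ) : ℚ) ≠ 0 := by
      have := k.2
      exact Nat.cast_ne_zero.2 (by omega)
    change (coef k.1.1 - coef k.1.2) • (((coef k.1.1 - coef k.1.2 : ℕ) : ℚ)⁻¹ •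
      ((ev F n (vec k.1.2)).1 x - (ev F n (vec k.1.1)).1 x)) = _
    rw [← Nat.cast_smul_eq_nsmul ℚ, smul_smul, mul_inv_cancel₀ hk, one_smul]
  have habs : ∀ k : J, absCoef n (vec k.1.1) (vec k.1.2) = coef k.1.1 - coef k.1.2 := by
    intro k
    have := k.2
    simp only [absCoef]
    change coef k.1.1 - coef k.1.2 + (coef k.1.2 - coef k.1.1) = _
    omega
  have habs' : ∀ k : J, absCoef n (vec k.1.2) (vec k.1.1) = coef k.1.1 - coef k.1.2 := by
    intro k
    rw [← habs, absCoef, absCoef, add_comm]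
  have hopp : ∀ i j : J, OppositeCoef n (vec i.1.1) (vec i.1.2) (vec j.1.2) (vec j.1.1) :=
    fun i j => .inl ⟨i.2, j.2⟩
  have hopp' : ∀ i j : J, OppositeCoef n (vec j.1.2) (vec j.1.1) (vec i.1.1) (vec i.1.2) :=
    fun i j => .inr ⟨j.2, i.2⟩
  have hlt : ∀ (i j : J) x, t j x < t i x ↔
      (coef j.1.1 - coef j.1.2) • (ev F n (vec i.1.1)).1 x +
        (coef i.1.1 - coef i.1.2) • (ev F n (vec j.1.2)).1 x <
      (coef j.1.1 - coef j.1.2) • (ev F n (vec i.1.2)).1 x +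
        (coef i.1.1 - coef i.1.2) • (ev F n (vec j.1.1)).1 x := fun i j x =>
    lt_iff_of_nsmul_eq (Nat.sub_pos_of_lt i.2) (Nat.sub_pos_of_lt j.2) (ht i x) (ht j x)
  have hel : ∀ (p r p' r' q q' : ℕ) (x : X), (ev F n (vec (elim n p r p' r' q q'))).1 x =
      absCoef n (vec p') (vec r') • (ev F n (vec q)).1 x +
        absCoef n (vec p) (vec r) • (ev F n (vec q')).1 x := fun p r p' r' q q' x => by
    rw [ev_elim]; rfl
  have hvar : ∀ p < m, ∀ r < m, ∀ p' < m, ∀ r' < m, ∀ q < m, ∀ q' < m, ∀ l < m, ∀ l' < m, ∀ x,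
      x ∈ (s (varIdx a n (elim n p r p' r' q q') (elim n p r p' r' l l'))).toSet ↔
        absCoef n (vec p') (vec r') • (ev F n (vec q)).1 x +
          absCoef n (vec p) (vec r) • (ev F n (vec q')).1 x <
        absCoef n (vec p') (vec r') • (ev F n (vec l)).1 x +
          absCoef n (vec p) (vec r) • (ev F n (vec l')).1 x := by
    intro p hp r hr p' hp' r' hr' q hq q' hq' l hl l' hl' x
    rw [h.2 _ (elim_lt hn hp hr hp' hr' hq hq') _ (elim_lt hn hp hr hp' hr' hl hl'), mem_ltSet,
      hel, hel]
  obtain ⟨f, hfC, hf⟩ := hC.exists_cut (J := J) htC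
    (Lo := fun k => (s (varIdx a (n + 1) k.1.1 k.1.2)).toSet)
    (Hi := fun k => (s (varIdx a (n + 1) k.1.2 k.1.1)).toSet)
    (fun k => (s _).2) (fun k => (s _).2)
    (fun k x => hdisj _ k.1.1.2 _ k.1.2.2 x)
    (by
      intro i j x hx
      have := hquad _ i.1.1.2 _ i.1.2.2 _ j.1.2.2 _ j.1.1.2 _
        (mem_quads.2 (.inr (.inl ⟨hopp i j, .inl rfl⟩))) x
      dsimp only at this
      rw [hvar _ i.1.1.2 _ i.1.2.2 _ j.1.2.2 _ j.1.1.2 _ i.1.1.2 _ j.1.2.2 _ i.1.2.2 _ j.1.1.2,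
        habs, habs', ← hlt] at this
      exact this hx hx)
    -- The second inclusion, applied to `i` and the reversed pair `j`, gives `h3`; the next block
    -- reverses the roles to get `h4`.
    (by
      intro i j x hx
      have := hquad _ i.1.1.2 _ i.1.2.2 _ j.1.2.2 _ j.1.1.2 _
        (mem_quads.2 (.inr (.inl ⟨hopp i j, .inr rfl⟩))) x
      dsimp only at this
      rw [hvar _ i.1.1.2 _ i.1.2.2 _ j.1.2.2 _ j.1.1.2 _ i.1.2.2 _ j.1.1.2 _ i.1.1.2 _ j.1.2.2,
        habs, habs'] at this
      refine (this hx hx).imp id fun h' => (hlt j i x).2 ?_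
      rwa [add_comm, add_comm (_ • _) ((coef j.1.1 - coef j.1.2) • _)])
    (by
      intro i j x hx
      have := hquad _ j.1.2.2 _ j.1.1.2 _ i.1.1.2 _ i.1.2.2 _
        (mem_quads.2 (.inr (.inl ⟨hopp' i j, .inr rfl⟩))) x
      dsimp only at this
      rw [hvar _ j.1.2.2 _ j.1.1.2 _ i.1.1.2 _ i.1.2.2 _ j.1.1.2 _ i.1.2.2 _ j.1.2.2 _ i.1.1.2,
        habs, habs', ← hlt] at this
      exact this hx hx)
  refine ⟨⟨f, hfC⟩, h.1, fun p hp r hr => CozeroSets.ext (Set.ext fun x => ?_)⟩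
  rw [mem_ltSet, ev_update, ev_update]
  change _ ↔ (ev F n (vec p)).1 x + coef p • f x < (ev F n (vec r)).1 x + coef r • f x
  -- The unequal cases are the upper and lower sides of a threshold; in the equal case the set is
  -- inherited from depth `n`.
  rcases lt_trichotomy (coef p) (coef r) with hc | hc | hc
  · have := (hf ⟨(⟨r, hr⟩, ⟨p, hp⟩), hc⟩).2
    dsimp only at this
    rw [this]
    exact nsmul_add_lt_iff hc (ht ⟨(⟨r, hr⟩, ⟨p, hp⟩), hc⟩ x)
  · rw [hc, add_lt_add_iff_right]
    have h1 := hquad p hp r hr p hp r hr _ (mem_quads.2 (.inr (.inr ⟨hc, .inl rfl⟩))) x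
    have h2 := hquad p hp r hr p hp r hr _ (mem_quads.2 (.inr (.inr ⟨hc, .inr rfl⟩))) x
    dsimp only at h1 h2
    rw [h.2 p (lt_level_of_lt_succ hn hp) r (lt_level_of_lt_succ hn hr), mem_ltSet] at h1 h2
    exact ⟨fun h' => (h2 h' h').resolve_right (hempty x),
      fun h' => (h1 h' h').resolve_right (hempty x)⟩
  · have := (hf ⟨(⟨p, hp⟩, ⟨r, hr⟩), hc⟩).1
    dsimp only at this
    rw [this]
    exact add_nsmul_lt_iff hc (ht ⟨(⟨p, hp⟩, ⟨r, hr⟩), hc⟩ x)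

end Semantics

/-! ### Correctness of the translation and the decision procedure -/

section Main

open FirstOrder Language

theorem termForm_two_mul (i : ℕ) : termForm (2 * i) = varForm i := by
  rw [termForm]
  simp

theorem termForm_two_mul_add_one (e : ℕ) : termForm (2 * e + 1) =
    funcForm e (termForm (firstArg e.unpair.2)) (termForm (firstArg (restArg e.unpair.2))) := by
  rw [termForm, if_neg (by omega), show (2 * e + 1) / 2 = e by omega]

theorem firstArg_encode_cons (c : ℕ) (l : List ℕ) :
    firstArg (Encodable.encode (c :: l)) = c := by
  simp [firstArg, Encodable.encode_list_cons]

theorem restArg_encode_cons (c : ℕ) (l : List ℕ) :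
    restArg (Encodable.encode (c :: l)) = Encodable.encode l := by
  simp [restArg, Encodable.encode_list_cons]

theorem termCode_func {L : FirstOrder.Language.{u, v}} [∀ k, Encodable (L.Functions k)] {n k : ℕ}
    (f : L.Functions k) (ts : Fin k → L.Term (Empty ⊕ Fin n)) :
    termCode (Term.func f ts) = 2 * Nat.pair (Encodable.encode f)
      (Encodable.encode (List.ofFn fun i => termCode (ts i))) + 1 := by
  rw [termCode]

theorem formulaCode_rel {L : FirstOrder.Language.{u, v}} [∀ k, Encodable (L.Functions k)]
    [∀ k, Encodable (L.Relations k)] {n k : ℕ}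
    (R : L.Relations k) (ts : Fin k → L.Term (Empty ⊕ Fin n)) :
    formulaCode (BoundedFormula.rel R ts) = Nat.pair 2 (Nat.pair (Encodable.encode R)
      (Encodable.encode (List.ofFn fun i => termCode (ts i)))) := by
  rw [formulaCode]

theorem translateCode_allCode (a c n : ℕ) :
    translateCode a (Nat.pair 4 c) n = blockCode a n (translateCode a c (n + 1)) := by
  rw [translateCode]
  simp only [Nat.unpair_pair]
  simp

theorem termCode_add {n : ℕ} (ts : Fin 2 → divLGroupLanguage.Term (Empty ⊕ Fin n)) :
    termCode (Term.func (L := divLGroupLanguage) DivLGroupFunc.add ts) =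
      2 * Nat.pair 0 (Encodable.encode [termCode (ts 0), termCode (ts 1)]) + 1 := by
  refine (termCode_func (L := divLGroupLanguage) (k := 2) DivLGroupFunc.add ts).trans ?_
  change 2 * Nat.pair 0 _ + 1 = _
  simp [List.ofFn_succ]

theorem termCode_sub {n : ℕ} (ts : Fin 2 → divLGroupLanguage.Term (Empty ⊕ Fin n)) :
    termCode (Term.func (L := divLGroupLanguage) DivLGroupFunc.sub ts) =
      2 * Nat.pair 1 (Encodable.encode [termCode (ts 0), termCode (ts 1)]) + 1 := by
  refine (termCode_func (L := divLGroupLanguage) (k := 2) DivLGroupFunc.sub ts).trans ?_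
  change 2 * Nat.pair 1 _ + 1 = _
  simp [List.ofFn_succ]

theorem termCode_smul {n : ℕ} (q : ℚ) (ts : Fin 1 → divLGroupLanguage.Term (Empty ⊕ Fin n)) :
    termCode (Term.func (L := divLGroupLanguage) (DivLGroupFunc.smul q) ts) =
      2 * Nat.pair (Nat.pair (Encodable.encode q.num) q.den)
        (Encodable.encode [termCode (ts 0)]) + 1 := by
  refine (termCode_func (L := divLGroupLanguage) (k := 1) (DivLGroupFunc.smul q) ts).trans ?_
  change 2 * Nat.pair (Nat.pair (Encodable.encode q.num) q.den) _ + 1 = _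
  simp [List.ofFn_succ]

variable {X : Type u} {M : Type v} [AddCommGroup M] [Module ℚ M] {C : Submodule ℚ (X → M)}

/-- `d` describes the linear form with value `y` at `F 0, …, F (n - 1)`. -/
def FormData.IsFormOf (F : ℕ → C) (n : ℕ) (d : FormData) (y : C) : Prop :=
  0 < d.1 ∧ d.1 • y = ev F n d.2.1 - ev F n d.2.2

theorem ev_nil (F : ℕ → C) (n : ℕ) : ev F n [] = 0 := by simp [ev]

theorem isFormOf_varForm (F : ℕ → C) (n : ℕ) (i : Fin n) :
    FormData.IsFormOf F n (varForm i) (F i) := by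
  refine ⟨Nat.one_pos, ?_⟩
  change 1 • F i = ev F n ((List.range (i + 1)).map fun j => if j = (i : ℕ) then 1 else 0) - ev F n []
  rw [ev_nil, sub_zero, one_smul, ev, Finset.sum_eq_single (i : ℕ)]
  · simp [List.getD_eq_getElem?_getD]
  · intro j _ hj
    by_cases h : j < i + 1
    · simp [List.getD_eq_getElem?_getD, h, hj]
    · rw [List.getD_eq_default _ _ (by simp; omega), zero_smul]
  · intro h
    exact absurd (Finset.mem_range.2 i.2) h

theorem FormData.IsFormOf.add {F : ℕ → C} {n : ℕ} {d d' : FormData} {y y' : C}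
    (h : d.IsFormOf F n y) (h' : d'.IsFormOf F n y') : (addForm d d').IsFormOf F n (y + y') := by
  refine ⟨Nat.mul_pos h.1 h'.1, ?_⟩
  simp only [addForm, ev_comb]
  rw [smul_add, mul_nsmul, h.2, mul_nsmul', h'.2, smul_sub, smul_sub]
  abel

theorem FormData.IsFormOf.sub {F : ℕ → C} {n : ℕ} {d d' : FormData} {y y' : C}
    (h : d.IsFormOf F n y) (h' : d'.IsFormOf F n y') : (subForm d d').IsFormOf F n (y - y') := by
  refine ⟨Nat.mul_pos h.1 h'.1, ?_⟩
  simp only [subForm, ev_comb]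
  rw [smul_sub, mul_nsmul, h.2, mul_nsmul', h'.2, smul_sub, smul_sub]
  abel

theorem FormData.IsFormOf.smul {F : ℕ → C} {n : ℕ} {d : FormData} {y : C} (q : ℚ)
    (h : d.IsFormOf F n y) :
    (smulForm (Nat.pair (Encodable.encode q.num) q.den) d).IsFormOf F n (q • y) := by
  have hden : ∀ z : C, q.den • q • z = q.num • z := by
    intro z
    rw [← Nat.cast_smul_eq_nsmul ℚ, smul_smul, mul_comm, Rat.mul_den_eq_num,
      Int.cast_smul_eq_zsmul]
  have key : (q.den * d.1) • q • y = q.num • (ev F n d.2.1 - ev F n d.2.2) := by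
    rw [mul_comm, mul_nsmul', hden, ← h.2, smul_comm]
  simp only [smulForm, Nat.unpair_pair]
  rcases hq : q.num with k | k
  · have he : Encodable.encode (Int.ofNat k) = 2 * k := rfl
    rw [he, if_pos (by omega), show 2 * k / 2 = k by omega]
    refine ⟨Nat.mul_pos q.den_pos h.1, ?_⟩
    simp only [ev_comb, ev_nil, smul_zero, add_zero]
    rw [key, hq, Int.ofNat_eq_natCast, natCast_zsmul, smul_sub]
  · have he : Encodable.encode (Int.negSucc k) = 2 * k + 1 := rfl
    rw [he, if_neg (by omega), show (2 * k + 1) / 2 = k by omega]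
    refine ⟨Nat.mul_pos q.den_pos h.1, ?_⟩
    simp only [ev_comb, ev_nil, smul_zero, add_zero]
    rw [key, hq, negSucc_zsmul, smul_sub, neg_sub]

variable [LinearOrder M]

theorem isFormOf_termForm (F : ℕ → C) {n : ℕ} (t : divLGroupLanguage.Term (Empty ⊕ Fin n))
    (w : Empty → C) :
    FormData.IsFormOf F n (termForm (termCode t)) (t.realize (Sum.elim w fun i : Fin n => F i)) := by
  induction t with
  | var i =>
    rcases i with e | i
    · exact e.elim
    · rw [termCode, termForm_two_mul]
      exact isFormOf_varForm F n i
  | func f ts ih =>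
    cases f with
    | add =>
      rw [termCode_add, termForm_two_mul_add_one]
      simp only [Nat.unpair_pair, funcForm, restArg_encode_cons, firstArg_encode_cons]
      rw [if_neg (by simp [Encodable.encode_list_cons]), if_pos trivial]
      exact (ih 0).add (ih 1)
    | sub =>
      rw [termCode_sub, termForm_two_mul_add_one]
      simp only [Nat.unpair_pair, funcForm, restArg_encode_cons, firstArg_encode_cons]
      rw [if_neg (by simp [Encodable.encode_list_cons]), if_neg (by omega)]
      exact (ih 0).sub (ih 1)
    | smul q =>
      rw [termCode_smul, termForm_two_mul_add_one]
      simp only [Nat.unpair_pair, funcForm, restArg_encode_cons, firstArg_encode_cons]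
      rw [if_pos (by simp)]
      exact (ih 0).smul q

theorem FormData.IsFormOf.lt_iff [IsOrderedAddMonoid M] {F : ℕ → C} {n c c' : ℕ} {y y' : C}
    (h : (termForm c).IsFormOf F n y) (h' : (termForm c').IsFormOf F n y') (x : X) :
    y'.1 x < y.1 x ↔ (ev F n (ltForm c c').1).1 x < (ev F n (ltForm c c').2).1 x := by
  have e : (termForm c).1 • y.1 x =
      (ev F n (termForm c).2.1).1 x - (ev F n (termForm c).2.2).1 x :=
    congrArg (fun z : C => z.1 x) h.2
  have e' : (termForm c').1 • y'.1 x =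
      (ev F n (termForm c').2.1).1 x - (ev F n (termForm c').2.2).1 x :=
    congrArg (fun z : C => z.1 x) h'.2
  rw [lt_iff_of_nsmul_eq h.1 h'.1 e e', ltForm, ev_comb, ev_comb, add_comm]
  rfl

variable [TopologicalSpace X] [TopologicalSpace M] [IsOrderedAddMonoid M]

/-- Translation of `t ≤ s`. -/
theorem exists_atomFormula (hC : IsConstructibleLGroup C) {a n c d : ℕ} (hc : c ≤ a) (hd : d ≤ a) :
    ∃ ψ : Language.order.BoundedFormula Empty (numVars a n), formulaCode ψ = atomCode a n c d ∧
      ∀ (v : Empty → CozeroSets (C : Set (X → M))) (F : ℕ → C) (s) (y y' : C),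
        Represents hC a n F s → (termForm c).IsFormOf F n y → (termForm d).IsFormOf F n y' →
        (ψ.Realize v (fun i => s i) ↔ y ≤ y') := by
  obtain ⟨h1, h2⟩ := encode_ltForm_lt hc hd
  have h1 := h1.trans_le (initBound_le_level a n)
  have h2 := h2.trans_le (initBound_le_level a n)
  refine ⟨leFormula ⟨_, varIdx_lt h1 h2⟩ ⟨0, numVars_pos a n⟩, formulaCode_leFormula _ _,
    fun v F s y y' hs hy hy' => ?_⟩
  rw [realize_leFormula]
  dsimp only
  rw [hs.2 _ h1 _ h2, CozeroSets.le_iff, hs.1, vec, vec, Denumerable.ofNat_encode,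
    Denumerable.ofNat_encode]
  constructor
  · intro h x
    exact not_lt.1 fun hx => h ((hy.lt_iff hy' x).1 hx)
  · intro h x hx
    exact absurd ((hy.lt_iff hy' x).2 hx) (not_lt.2 (h x))

variable [OrderTopology M]

/-- Induction on the formula. The budget `n + formulaCode φ ≤ a` survives a quantifier, since
stripping it lowers the code by at least `4` and raises the depth by one; it keeps `n < a` there and
all term codes at most `a`. -/
theorem exists_translation (hC : IsConstructibleLGroup C) (a : ℕ) {n : ℕ}
    (φ : divLGroupLanguage.BoundedFormula Empty n) (hφ : n + formulaCode φ ≤ a) :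
    ∃ ψ : Language.order.BoundedFormula Empty (numVars a n),
      formulaCode ψ = translateCode a (formulaCode φ) n ∧
      ∀ (w : Empty → C) (v : Empty → CozeroSets (C : Set (X → M))) (F : ℕ → C) (s),
        Represents hC a n F s →
        (φ.Realize w (fun i => F i) ↔ ψ.Realize v (fun i => s i)) := by
  induction φ with
  | falsum =>
    refine ⟨.falsum, ?_, fun w v F s _ => Iff.rfl⟩
    rw [translateCode]
    simp [formulaCode, falsumCode]
  | @equal n t t' =>
    simp only [formulaCode] at hφ
    have b1 := Nat.add_le_pair 1 (Nat.pair (termCode t) (termCode t'))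
    have b2 := Nat.add_le_pair (termCode t) (termCode t')
    obtain ⟨ψ, hψ, h⟩ := exists_atomFormula (n := n) hC (show termCode t ≤ a by omega)
      (show termCode t' ≤ a by omega)
    obtain ⟨ψ', hψ', h'⟩ := exists_atomFormula (n := n) hC (show termCode t' ≤ a by omega)
      (show termCode t ≤ a by omega)
    refine ⟨(ψ.imp (ψ'.imp .falsum)).imp .falsum, ?_, fun w v F s hs => ?_⟩
    · have hf : formulaCode (.falsum : Language.order.BoundedFormula Empty (numVars a n)) =
        falsumCode := rfl
      rw [formulaCode_imp, formulaCode_imp, formulaCode_imp, hf, hψ, hψ', translateCode]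
      simp only [formulaCode, Nat.unpair_pair]
      simp [eqCode]
    · have ht := isFormOf_termForm F t w
      have ht' := isFormOf_termForm F t' w
      have hR : ∀ θ : Language.order.BoundedFormula Empty (numVars a n),
          (θ.imp .falsum).Realize v (fun i => s i) ↔ ¬ θ.Realize v (fun i => s i) :=
        fun θ => Iff.rfl
      rw [hR, BoundedFormula.realize_imp, hR, h v F s _ _ hs ht ht', h' v F s _ _ hs ht' ht]
      change _ = _ ↔ _
      rw [le_antisymm_iff]
      tauto
  | @rel n k R ts =>
    cases R with
    | le =>
      have hcode : formulaCode (BoundedFormula.rel (L := divLGroupLanguage) DivLGroupRel.le ts) =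
          Nat.pair 2 (Nat.pair 0 (Encodable.encode [termCode (ts 0), termCode (ts 1)])) := by
        refine (formulaCode_rel (L := divLGroupLanguage) (k := 2) DivLGroupRel.le ts).trans ?_
        change Nat.pair 2 (Nat.pair 0 _) = _
        simp [List.ofFn_succ]
      rw [hcode] at hφ ⊢
      have b1 := Nat.add_le_pair 2
        (Nat.pair 0 (Encodable.encode [termCode (ts 0), termCode (ts 1)]))
      have b2 := Nat.add_le_pair 0 (Encodable.encode [termCode (ts 0), termCode (ts 1)])
      have b3 := firstArg_le (Encodable.encode [termCode (ts 0), termCode (ts 1)])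
      have b4 := firstArg_le (restArg (Encodable.encode [termCode (ts 0), termCode (ts 1)]))
      have b5 := restArg_le (Encodable.encode [termCode (ts 0), termCode (ts 1)])
      rw [firstArg_encode_cons] at b3
      rw [restArg_encode_cons, firstArg_encode_cons] at b4
      rw [restArg_encode_cons] at b5
      obtain ⟨ψ, hψ, h⟩ := exists_atomFormula (n := n) hC (show termCode (ts 0) ≤ a by omega)
        (show termCode (ts 1) ≤ a by omega)
      refine ⟨ψ, ?_, fun w v F s hs => ?_⟩
      · rw [translateCode, hψ]
        simp only [Nat.unpair_pair, firstArg_encode_cons, restArg_encode_cons]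
        simp
      · rw [h v F s _ _ hs (isFormOf_termForm F (ts 0) w) (isFormOf_termForm F (ts 1) w)]
        exact Iff.rfl
  | @imp n φ φ' ih ih' =>
    simp only [formulaCode] at hφ
    have b1 := Nat.add_le_pair 3 (Nat.pair (formulaCode φ) (formulaCode φ'))
    have b2 := Nat.add_le_pair (formulaCode φ) (formulaCode φ')
    obtain ⟨ψ, hψ, h⟩ := ih (by omega)
    obtain ⟨ψ', hψ', h'⟩ := ih' (by omega)
    refine ⟨ψ.imp ψ', ?_, fun w v F s hs => ?_⟩
    · rw [translateCode, formulaCode_imp, hψ, hψ']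
      simp only [formulaCode, Nat.unpair_pair]
      simp
    · rw [BoundedFormula.realize_imp, BoundedFormula.realize_imp, h w v F s hs, h' w v F s hs]
  | @all n φ ih =>
    simp only [formulaCode] at hφ
    have b1 := Nat.add_le_pair 4 (formulaCode φ)
    have hn : n < a := by omega
    obtain ⟨ψ, hψ, h⟩ := ih (by omega)
    obtain ⟨χ, hχ, h'⟩ := exists_quadsFormula hC (blockQuads a n)
      (fun q hq => lt_numVars_of_mem_blockQuads hn hq) ψ
    obtain ⟨θ, hθ, h''⟩ := exists_alls (S := CozeroSets (C : Set (X → M))) (m := numVars a n)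
      (level a (n + 1) ^ 2) χ
    refine ⟨θ, ?_, fun w v F s hs => ?_⟩
    · refine hθ.trans ((congrArg _ hχ).trans ?_)
      simp only [formulaCode]
      rw [hψ, translateCode_allCode, blockCode]
    · rw [h'' v s, BoundedFormula.realize_all]
      constructor
      · intro H s' hs'
        refine (h' v s').2 fun hq => ?_
        -- A table satisfying the constraints comes from a function; conversely, below, the table of
        -- a function satisfies them.
        obtain ⟨f, hf⟩ := (hs.congr hs').exists_of_quadHolds hn hq
        have := H f
        rw [snoc_restrict] at this
        exact (h w v _ _ hf).1 this
      · intro H f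
        rw [snoc_restrict]
        obtain ⟨s', hs', hf⟩ := hs.exists_succ f
        exact (h w v _ _ hf).2 ((h' v s').1 (H s' hs') ((hs.congr hs').quadHolds hn hf))

theorem isDecidableStructure_of_cozeroSets (hC : IsConstructibleLGroup C)
    (hL : IsDecidableStructure Language.order (CozeroSets (C : Set (X → M)))) :
    IsDecidableStructure divLGroupLanguage C := by
  obtain ⟨alg, halg, hspec⟩ := hL
  refine ⟨fun c => alg (translateSentence c),
    halg.comp primrec_translateSentence.to_comp, fun φ => ?_⟩
  obtain ⟨ψ, hψ, h⟩ := exists_translation hC (formulaCode φ) φ (by omega)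
  let Ψ : Language.order.Sentence :=
    BoundedFormula.all ((BoundedFormula.all (leFormula (m := 2) 0 1)).imp ψ)
  have hΨ : formulaCode Ψ = translateSentence (formulaCode φ) := by
    simp only [Ψ, translateSentence, ← hψ]
    rw [formulaCode_all]
    refine congrArg allCode ((formulaCode_imp _ _).trans ?_)
    rw [formulaCode_all, formulaCode_leFormula]
    rfl
  change alg (translateSentence (formulaCode φ)) = true ↔ _
  rw [← hΨ, hspec]
  have hempty : IsCozeroSetOf (C : Set (X → M)) ∅ :=
    ⟨0, C.zero_mem, by ext x; simp⟩
  let e : CozeroSets (C : Set (X → M)) := Subtype.mk ∅ hempty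
  -- Without variables both forms are empty sums, so an empty variable `0` is all that
  -- representation requires.
  have hrep : ∀ s : ℕ → CozeroSets (C : Set (X → M)), (s 0).toSet = ∅ →
      Represents hC (formulaCode φ) 0 (fun _ => 0) s := by
    refine fun s hs => ⟨hs, fun p _ r _ => CozeroSets.ext ?_⟩
    refine Eq.trans hs ?_
    ext x
    simp [mem_ltSet, ev]
  have key : ∀ s : ℕ → CozeroSets (C : Set (X → M)), (s 0).toSet = ∅ →
      ((C ⊨ φ) ↔ ψ.Realize default (fun i => s i)) := fun s hs => by
    rw [← h default default (fun _ => 0) s (hrep s hs)]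
    have hirr : ∀ (w w' : Empty → C) (x x' : Fin 0 → C),
        BoundedFormula.Realize φ w x ↔ BoundedFormula.Realize φ w' x' := fun w w' x x' => by
      rw [Subsingleton.elim w w', Subsingleton.elim x x']
    exact hirr _ _ _ _
  -- The empty set is the cozero set of the zero function, hence the least element.
  have hbot : ∀ U : CozeroSets (C : Set (X → M)), (∀ V, U ≤ V) → U.toSet = ∅ := fun U hU =>
    Set.subset_empty_iff.1 (hU e)
  have hsnoc : (fun _ : Fin (numVars (formulaCode φ) 0) => e) =
      (Fin.snoc (default : Fin 0 → CozeroSets (C : Set (X → M))) e : Fin 1 → _) := by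
    refine funext fun i : Fin 1 => ?_
    rw [Subsingleton.elim i (Fin.last 0), Fin.snoc_last]
  rw [key (fun _ => e) rfl, hsnoc]
  constructor
  · intro H
    have h1 := BoundedFormula.realize_imp.1 (BoundedFormula.realize_all.1 H e)
    have h2 := h1 (BoundedFormula.realize_all.2 fun V => (Set.empty_subset V.toSet))
    exact h2
  · intro H
    refine BoundedFormula.realize_all.2 fun U => BoundedFormula.realize_imp.2 fun hU => ?_
    have hU' : U = e := CozeroSets.ext (hbot U fun V => BoundedFormula.realize_all.1 hU V)
    subst hU'
    exact H

end Main

theorem corollary3p9 :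
    (∀ (M : Type*) [AddCommGroup M] [LinearOrder M] [IsOrderedAddMonoid M] [Module ℚ M]
        [TopologicalSpace M] [OrderTopology M]
        (X : Type*) [TopologicalSpace X] [T2Space X] (C : Submodule ℚ (X → M)),
        IsConstructibleLGroup C →
        IsDecidableStructure FirstOrder.Language.order (CozeroSets (C : Set (X → M))) →
        IsDecidableStructure divLGroupLanguage C) ∧
    (∀ (X : Type*) [TopologicalSpace X] [T2Space X] [PerfectlyNormalSpace X],
        IsDecidableStructure FirstOrder.Language.order
          (CozeroSets (continuousSubmodule X ℚ ℝ : Set (X → ℝ))) →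
        IsDecidableStructure divLGroupLanguage (continuousSubmodule X ℚ ℝ)) :=
  ⟨fun _ _ _ _ _ _ _ _ _ _ _ hC hL => isDecidableStructure_of_cozeroSets hC hL,
    fun X _ _ _ hL =>
      isDecidableStructure_of_cozeroSets (isConstructibleLGroup_continuousSubmodule X) hL⟩
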